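/- **Setting.** Let $V=(v_{ij})_{i,j\ge 0}$ be an array of i.i.d. real random variables with mean zero, unit variance and finite fourth moment, let $(l_i)_{i\ge0}$ be i.i.d. with $\mathbb E[l_0^2]=1$ and $|l_0|\ge c$ almost surely for some $c>0$, and let $(u_i)_{i\ge 0}$ be i.i.d. with arbitrary distribution; the three arrays are jointly independent. Let $(p_n)$ be a sequence of dimensions and let $S_p$ denote the set of symmetric positive definite $p\times p$ matrices. For $\beta\in\mathbb R^{p_n}$, $\sigma>0$ and $\Sigma\in S_{p_n}$, with $\Sigma^{1/2}$ the symmetric positive definite square root of $\Sigma$, put $$x_i=\Sigma^{1/2}l_i(v_{i1},\dots,v_{ip_n})',\qquad y_i=\beta'x_i+\sigma u_i,\qquad i=0,1,2,\dots$$ Write $\mathbb P_{\beta,\sigma^2,\Sigma}$, $\mathbb E_{\beta,\sigma^2,\Sigma}$ for probability and expectation under these parameters. The training sample is $(y_i,x_i)_{i=1}^n$, with $Y=(y_1,\dots,y_n)'$, $X=[x_1,\dots,x_n]'$. A measurable estimation rule, defined for every sample size and every number of regressors, gives $\hat\beta_n\in\mathbb R^{p_n}$ when applied to the training sample, and $\hat\beta_{(i),n}\in\mathbb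 R^{p_n}$ when applied to the training sample without the pair $(y_i,x_i)$. Put $\tilde u_i=y_i-x_i'\hat\beta_{(i),n}$ for $1\le i\le n$. For $a\in(0,1)$ let $\tilde q_{n,a}$ be an empirical $a$-quantile of $\tilde u_1,\dots,\tilde u_n$, that is, a measurable function of these residuals with $\#\{i:\tilde u_i\le\tilde q_{n,a}\}\ge na\ge\#\{i:\tilde u_i<\tilde q_{n,a}\}$. For $\alpha\in(0,1)$ the leave-one-out prediction interval is $$PI_\alpha=\big[x_0'\hat\beta_n+\tilde q_{n,\alpha/2},\;x_0'\hat\beta_n+\tilde q_{n,1-\alpha/2}\big].$$ It is called uniformly asymptotically conditionally valid if $$\sup_{\beta\in\mathbb R^{p_n},\,\sigma^2>0,\,\Sigma\in S_{p_n}}\mathbb E_{\beta,\sigma^2,\Sigma}\Big[\big|\mathbb P_{\beta,\sigma^2,\Sigma}(y_0\in PI_\alpha\mid Y,X)-(1-\alpha)\big|\Big]\xrightarrow[n\to\infty]{}0 .$$ **Conditions.** (C1) with constant $\tau\in[0,\infty)$: (a) for every $n$, the map $(w_1,\dots,w_n)\mapsto\hat\beta_n$, $w_i=(y_i,x_i')'\in\mathbb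 R^{p_n+1}$, is invariant under permutations of $w_1,\dots,w_n$; and for every $\varepsilon>0$, as $n\to\infty$, $$\text{(b)}\ \sup_{\beta,\sigma^2,\Sigma}\mathbb P_{\beta,\sigma^2,\Sigma}\Big(\big|\|\Sigma^{1/2}(\hat\beta_n-\beta)/\sigma\|_2-\tau\big|>\varepsilon\Big)\to0,\qquad \text{(c)}\ \sup_{\beta,\sigma^2,\Sigma}\mathbb P_{\beta,\sigma^2,\Sigma}\Big(\|\Sigma^{1/2}(\hat\beta_n-\hat\beta_{(1),n})/\sigma\|_2>\varepsilon\Big)\to0 .$$ (C2): there is $\delta\in(0,2]$ such that for every $\varepsilon>0$, $\sup_{\beta,\sigma^2,\Sigma}\mathbb P_{\beta,\sigma^2,\Sigma}\big(\|\Sigma^{1/2}(\hat\beta_n-\beta)/\sigma\|_{2+\delta}>\varepsilon\big)\to0$ as $n\to\infty$. **Theorem.** Let $\alpha\in(0,1)$. (i) If (C1) holds with $\tau>0$, if $p_n\to\infty$, and if (C2) holds or $v_{ij}\sim\mathcal N(0,1)$, then $PI_\alpha$ is uniformly asymptotically conditionally valid. (ii) If (C1) holds with $\tau=0$ and the distribution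 function of $u_0$ is continuous and strictly increasing, then $PI_\alpha$ is uniformly asymptotically conditionally valid. (iii) Under the assumptions of (i) or of (ii), for every sequence of parameters $(\beta_n,\sigma_n^2,\Sigma_n)$ in $\mathbb R^{p_n}\times(0,\infty)\times S_{p_n}$, the scaled length $\ell_n=(\tilde q_{n,1-\alpha/2}-\tilde q_{n,\alpha/2})/\sigma_n$ of $PI_\alpha$ under these parameters converges in probability to $q_{1-\alpha/2}-q_{\alpha/2}$, where $q_a$ is the $a$-quantile of the distribution of $l_0N\tau+u_0$ and $N\sim\mathcal N(0,1)$ is independent of $(l_0,u_0)$. -/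

import Mathlib

open MeasureTheory ProbabilityTheory Filter Topology
open scoped ENNReal MatrixOrder RealInnerProductSpace

namespace LooPred

noncomputable section

/-- An observation `(y, x)`: a response and a vector of `k` regressors. -/
abbrev Obs (k : ℕ) : Type := ℝ × EuclideanSpace ℝ (Fin k)

/-- An estimation rule: it maps a sample of any size `m`, with any number `k` of regressors, to
an estimate in `ℝ^k`. -/
abbrev Estimator : Type := (m k : ℕ) → (Fin m → Obs k) → EuclideanSpace ℝ (Fin k)

/-- A rule that picks, for every sample size `m`, every level `a` and every real sample of size
`m`, a candidate for an empirical `a`-quantile. -/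
abbrev QuantileRule : Type := (m : ℕ) → ℝ → (Fin m → ℝ) → ℝ

/-- The unknown parameters `(β, σ, Σ)`, with `σ > 0` and `Σ` symmetric and positive definite. -/
structure Param (k : ℕ) where
  β : EuclideanSpace ℝ (Fin k)
  σ : ℝ
  S : Matrix (Fin k) (Fin k) ℝ
  σ_pos : 0 < σ
  S_posDef : S.PosDef

/-- `Σ^{1/2} b`, with the positive semidefinite square root of `Σ`. -/
def Param.rootMul {k : ℕ} (θ : Param k) (b : EuclideanSpace ℝ (Fin k)) :
    EuclideanSpace ℝ (Fin k) :=
  WithLp.toLp 2 ((CFC.sqrt θ.S).mulVec b.ofLp)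

/-- The `ℓ_q`-norm `(∑_j |b_j|^q)^{1/q}`. -/
def lqNorm {k : ℕ} (q : ℝ) (b : EuclideanSpace ℝ (Fin k)) : ℝ :=
  (∑ j, |b j| ^ q) ^ (1 / q)

/-- `t` is an empirical `a`-quantile of the sample `z_1, …, z_m`: at least a proportion `a` of
the sample is `≤ t`, and at most a proportion `a` of it is `< t`. -/
def IsEmpiricalQuantile {m : ℕ} (a : ℝ) (z : Fin m → ℝ) (t : ℝ) : Prop :=
  a * m ≤ (Finset.univ.filter (fun i => z i ≤ t)).card ∧
    ((Finset.univ.filter (fun i => z i < t)).card : ℝ) ≤ a * m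

/-- The rule returns empirical quantiles for all non-empty samples and all levels in `(0, 1)`,
and does so measurably. -/
def QuantileRule.IsValid (qhat : QuantileRule) : Prop :=
  ∀ m : ℕ, 0 < m → ∀ a : ℝ, 0 < a → a < 1 →
    Measurable (qhat m a) ∧ ∀ z : Fin m → ℝ, IsEmpiricalQuantile a z (qhat m a z)

/-- The residual of observation `i` with respect to the estimate from the sample without `i`. -/
def looResidual (bhat : Estimator) {n k : ℕ} (w : Fin (n + 1) → Obs k) (i : Fin (n + 1)) : ℝ :=
  (w i).1 - ⟪(w i).2, bhat n k (i.removeNth w)⟫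

/-- The leave-one-out prediction interval at the regressor vector `x₀`. -/
def looInterval (bhat : Estimator) (qhat : QuantileRule) (α : ℝ) {n k : ℕ}
    (w : Fin (n + 1) → Obs k) (x₀ : EuclideanSpace ℝ (Fin k)) : Set ℝ :=
  Set.Icc (⟪x₀, bhat (n + 1) k w⟫ + qhat (n + 1) (α / 2) (looResidual bhat w))
    (⟪x₀, bhat (n + 1) k w⟫ + qhat (n + 1) (1 - α / 2) (looResidual bhat w))

/-- The length of the leave-one-out prediction interval. -/
def looLength (bhat : Estimator) (qhat : QuantileRule) (α : ℝ) {n k : ℕ}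
    (w : Fin (n + 1) → Obs k) : ℝ :=
  qhat (n + 1) (1 - α / 2) (looResidual bhat w) - qhat (n + 1) (α / 2) (looResidual bhat w)

section Model

variable {Ω : Type*} [MeasurableSpace Ω]

/-- The three arrays `v`, `l`, `u` put into one family of random variables. -/
def allVars (v : ℕ → ℕ → Ω → ℝ) (l u : ℕ → Ω → ℝ) : (ℕ × ℕ) ⊕ (ℕ ⊕ ℕ) → Ω → ℝ :=
  Sum.elim (fun ij => v ij.1 ij.2) (Sum.elim l u)

/-- The distributional assumptions: `v` is an i.i.d. array with mean zero, unit variance and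
finite fourth moment; `l` is an i.i.d. sequence with `E[l₀²] = 1` and `|l₀|` bounded away from
zero; `u` is an i.i.d. sequence; and the three arrays are jointly independent. -/
structure IsDataModel (P : Measure Ω) (v : ℕ → ℕ → Ω → ℝ) (l u : ℕ → Ω → ℝ) : Prop where
  meas_v : ∀ i j, Measurable (v i j)
  meas_l : ∀ i, Measurable (l i)
  meas_u : ∀ i, Measurable (u i)
  indep : iIndepFun (allVars v l u) P
  ident_v : ∀ i j, IdentDistrib (v i j) (v 0 0) P P
  ident_l : ∀ i, IdentDistrib (l i) (l 0) P P
  ident_u : ∀ i, IdentDistrib (u i) (u 0) P P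
  mean_v : ∫ ω, v 0 0 ω ∂P = 0
  var_v : ∫ ω, v 0 0 ω ^ 2 ∂P = 1
  fourth_v : MemLp (v 0 0) 4 P
  second_l : ∫ ω, l 0 ω ^ 2 ∂P = 1
  lower_l : ∃ c : ℝ, 0 < c ∧ ∀ᵐ ω ∂P, c ≤ |l 0 ω|

/-- The regressor vector `x_i = Σ^{1/2} l_i (v_{i1}, …, v_{ik})'`. -/
def regressor (v : ℕ → ℕ → Ω → ℝ) (l : ℕ → Ω → ℝ) {k : ℕ} (θ : Param k) (i : ℕ) (ω : Ω) :
    EuclideanSpace ℝ (Fin k) :=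
  θ.rootMul (l i ω • WithLp.toLp 2 (fun j : Fin k => v i (j + 1) ω))

/-- The response `y_i = β'x_i + σ u_i`. -/
def response (v : ℕ → ℕ → Ω → ℝ) (l u : ℕ → Ω → ℝ) {k : ℕ} (θ : Param k) (i : ℕ) (ω : Ω) : ℝ :=
  ⟪θ.β, regressor v l θ i ω⟫ + θ.σ * u i ω

/-- The training sample `(y_1, x_1), …, (y_m, x_m)`. -/
def training (v : ℕ → ℕ → Ω → ℝ) (l u : ℕ → Ω → ℝ) {k : ℕ} (θ : Param k) (m : ℕ) (ω : Ω) :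
    Fin m → Obs k :=
  fun i => (response v l u θ (i + 1) ω, regressor v l θ (i + 1) ω)

/-- `Σ^{1/2} (β̂ - β) / σ`, with `β̂` computed from the training sample of size `m`. -/
def scaledError (v : ℕ → ℕ → Ω → ℝ) (l u : ℕ → Ω → ℝ) (bhat : Estimator) {k : ℕ}
    (θ : Param k) (m : ℕ) (ω : Ω) : EuclideanSpace ℝ (Fin k) :=
  θ.σ⁻¹ • θ.rootMul (bhat m k (training v l u θ m ω) - θ.β)

/-- `Σ^{1/2} (β̂ - β̂_(1)) / σ`, with `β̂` computed from the training sample of size `n + 1` and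
`β̂_(1)` from the same sample without its first observation. -/
def scaledInfluence (v : ℕ → ℕ → Ω → ℝ) (l u : ℕ → Ω → ℝ) (bhat : Estimator) {k : ℕ}
    (θ : Param k) (n : ℕ) (ω : Ω) : EuclideanSpace ℝ (Fin k) :=
  θ.σ⁻¹ • θ.rootMul (bhat (n + 1) k (training v l u θ (n + 1) ω) -
    bhat n k ((0 : Fin (n + 1)).removeNth (training v l u θ (n + 1) ω)))

/-- Condition (C1) with limit `τ`. The sample size is `n + 1` in the two limits. -/
structure CondC1 (P : Measure Ω) (v : ℕ → ℕ → Ω → ℝ) (l u : ℕ → Ω → ℝ) (p : ℕ → ℕ)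
    (bhat : Estimator) (τ : ℝ) : Prop where
  symmetric : ∀ (n : ℕ) (w : Fin n → Obs (p n)) (π : Equiv.Perm (Fin n)),
    bhat n (p n) (w ∘ π) = bhat n (p n) w
  error_tendsto : ∀ ε : ℝ, 0 < ε →
    Tendsto (fun n : ℕ => ⨆ θ : Param (p (n + 1)),
      P {ω | ε < |‖scaledError v l u bhat θ (n + 1) ω‖ - τ|}) atTop (𝓝 0)
  influence_tendsto : ∀ ε : ℝ, 0 < ε →
    Tendsto (fun n : ℕ => ⨆ θ : Param (p (n + 1)),
      P {ω | ε < ‖scaledInfluence v l u bhat θ n ω‖}) atTop (𝓝 0)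

/-- Condition (C2): uniform consistency in `ℓ_{2+δ}`-norm for some `δ ∈ (0, 2]`. -/
def CondC2 (P : Measure Ω) (v : ℕ → ℕ → Ω → ℝ) (l u : ℕ → Ω → ℝ) (p : ℕ → ℕ)
    (bhat : Estimator) : Prop :=
  ∃ δ : ℝ, 0 < δ ∧ δ ≤ 2 ∧ ∀ ε : ℝ, 0 < ε →
    Tendsto (fun n : ℕ => ⨆ θ : Param (p (n + 1)),
      P {ω | ε < lqNorm (2 + δ) (scaledError v l u bhat θ (n + 1) ω)}) atTop (𝓝 0)

/-- The conditional probability, given the training sample of size `n + 1`, that the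
leave-one-out prediction interval contains the future response `y_0`. -/
def condCoverage (P : Measure Ω) (v : ℕ → ℕ → Ω → ℝ) (l u : ℕ → Ω → ℝ) (bhat : Estimator)
    (qhat : QuantileRule) (α : ℝ) {k : ℕ} (θ : Param k) (n : ℕ) : Ω → ℝ :=
  P⟦{ω | response v l u θ 0 ω ∈
      looInterval bhat qhat α (training v l u θ (n + 1) ω) (regressor v l θ 0 ω)} |
    MeasurableSpace.comap (training v l u θ (n + 1)) inferInstance⟧

/-- Uniform asymptotic conditional validity at level `1 - α`. -/
def IsHonest (P : Measure Ω) (v : ℕ → ℕ → Ω → ℝ) (l u : ℕ → Ω → ℝ) (p : ℕ → ℕ)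
    (bhat : Estimator) (qhat : QuantileRule) (α : ℝ) : Prop :=
  Tendsto (fun n : ℕ => ⨆ θ : Param (p (n + 1)),
    ∫⁻ ω, ENNReal.ofReal |condCoverage P v l u bhat qhat α θ n ω - (1 - α)| ∂P) atTop (𝓝 0)

/-- The assumptions of the case `τ > 0`. -/
structure CasePos (P : Measure Ω) (v : ℕ → ℕ → Ω → ℝ) (l u : ℕ → Ω → ℝ) (p : ℕ → ℕ)
    (bhat : Estimator) (τ : ℝ) : Prop where
  pos : 0 < τ
  condC1 : CondC1 P v l u p bhat τ
  dim_tendsto : Tendsto p atTop atTop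
  c2_or_gauss : CondC2 P v l u p bhat ∨ ∀ i j, P.map (v i j) = gaussianReal 0 1

/-- The assumptions of the case `τ = 0`. -/
structure CaseZero (P : Measure Ω) (v : ℕ → ℕ → Ω → ℝ) (l u : ℕ → Ω → ℝ) (p : ℕ → ℕ)
    (bhat : Estimator) (τ : ℝ) : Prop where
  eq_zero : τ = 0
  condC1 : CondC1 P v l u p bhat τ
  cdf_continuous : Continuous (cdf (P.map (u 0)))
  cdf_strictMono : StrictMono (cdf (P.map (u 0)))

/-- The law of `l₀ N τ + u₀`, where `N` is standard normal and independent of `(l₀, u₀)`. -/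
def limitLaw (P : Measure Ω) (l u : ℕ → Ω → ℝ) (τ : ℝ) : Measure ℝ :=
  ((P.map (fun ω => (l 0 ω, u 0 ω))).prod (gaussianReal 0 1)).map
    (fun z : (ℝ × ℝ) × ℝ => z.1.1 * z.2 * τ + z.1.2)

/-- The `a`-quantile `inf {t : a ≤ F(t)}` of a probability measure on `ℝ` with cdf `F`. -/
def quantile (ν : Measure ℝ) (a : ℝ) : ℝ := sInf {t : ℝ | a ≤ cdf ν t}

/-- The inter-quantile range `q_{1-α/2} - q_{α/2}` of the law of `l₀ N τ + u₀`. -/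
def limitLength (P : Measure Ω) (l u : ℕ → Ω → ℝ) (τ α : ℝ) : ℝ :=
  quantile (limitLaw P l u τ) (1 - α / 2) - quantile (limitLaw P l u τ) (α / 2)

end Model

end

end LooPred

/-!
The proof rests on one observation about the leave-one-out residuals. After standardization, that
is, writing `x_i = Σ^{1/2} z_i` and `d = Σ^{1/2} (β̂ - β) / σ`, the error of predicting `y_0` is `σ`
times `predError (z_0, u_0) d = u_0 - ⟪z_0, d⟫`, and the `i`-th residual is `σ` times
`predError (z_i, u_i) d_(i)`, where `d_(i)` is computed without observation `i`. So only two random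
laws on the line have to be compared with the law `limitLaw` of `l₀ N τ + u₀`: the conditional law
`errorLaw` of the prediction error given the sample, and the empirical law of the residuals.

*The conditional law.* The fresh observation is independent of the sample, so `d` may be frozen.
For deterministic vectors `d` with `‖d‖ → τ`, the characteristic function of `u_0 - ⟪z_0, d⟫` is,
conditionally on `(l_0, u_0)`, a product over the coordinates; it converges to a Gaussian one when
the coordinates of `d` vanish uniformly (a Lindeberg argument, `tendsto_prod_charFun`) or when the
design is Gaussian. Under (C2) the largest coordinate vanishes because it is at most the
`ℓ_{2+δ}`-norm; for `τ = 0` it is at most the Euclidean norm. This gives convergence in probability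
of the integrals of bounded continuous functions, `IsDataModel.tendstoInMeasure_integral_errorLaw`.

*The empirical law.* The average of `φ (predError (z_i, u_i) d_(i))`, with `φ` bounded and
Lipschitz and centred at its limit, has a small second moment (`integral_sq_average_le`). Only the
cross moments matter; in these, observation `i` is overwritten by a fresh draw, which turns one
factor into a conditional mean, small by the previous paragraph, at the price of a few influence
terms of the form `‖d - d_(i)‖`. By symmetry of the full-sample estimator these all have the law of
`‖d - d_(1)‖`, which (C1) makes small. The estimator on the reduced sample is never permuted.

*Conclusion.* Distribution functions are squeezed between integrals of ramps, so both random
distribution functions converge pointwise in probability to that of `limitLaw`, which is continuous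
and strictly increasing in either case (`CasePos.regular`, `CaseZero.regular`). Hence the empirical
quantiles converge, which is the statement on the length, and the conditional coverage, the mass
that `errorLaw` gives to the interval between them (`IsDataModel.condCoverage_ae_eq`), converges to
`1 - α`. Uniformity over the parameters holds because all of this is true along every sequence of
parameters.
-/

namespace LooPred

set_option linter.unusedSectionVars false

/-! ### Resampling one coordinate of an i.i.d. sample -/

section Resampling

variable {Z E : Type*} [MeasurableSpace Z] [MeasurableSpace E]

theorem measurePreserving_removeNth (ν : Measure Z) [IsProbabilityMeasure ν] {n : ℕ}
    (i : Fin (n + 1)) :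
    MeasurePreserving (fun w : Fin (n + 1) → Z => i.removeNth w)
      (Measure.pi fun _ => ν) (Measure.pi fun _ => ν) :=
  measurePreserving_snd.comp (measurePreserving_piFinSuccAbove (fun _ => ν) i)

/-- Overwriting one coordinate of an i.i.d. sample by a fresh draw gives an i.i.d. sample. -/
theorem measurePreserving_update (ν : Measure Z) [IsProbabilityMeasure ν] {n : ℕ}
    (i : Fin (n + 1)) :
    MeasurePreserving (fun q : Z × (Fin (n + 1) → Z) => Function.update q.2 i q.1)
      (ν.prod (Measure.pi fun _ => ν)) (Measure.pi fun _ => ν) := by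
  have h1 := (MeasurePreserving.id ν).prod (measurePreserving_removeNth ν i)
  have h2 := (measurePreserving_piFinSuccAbove (fun _ : Fin (n + 1) => ν) i).symm.comp h1
  convert h2 using 1
  funext q
  simp only [Function.comp, MeasurableEquiv.piFinSuccAbove]
  exact (Fin.insertNth_removeNth i q.1 q.2).symm

theorem removeNth_update_self {n : ℕ} (i : Fin (n + 1)) (w : Fin (n + 1) → Z) (x : Z) :
    i.removeNth (Function.update w i x) = i.removeNth w := by
  funext j
  simp [Fin.removeNth]

theorem removeNth_update_comm {n : ℕ} {i j : Fin (n + 1)} (hij : i ≠ j)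
    (w : Fin (n + 1) → Z) (x y : Z) :
    j.removeNth (Function.update (Function.update w j y) i x) =
      j.removeNth (Function.update w i x) := by
  rw [Function.update_comm hij.symm, removeNth_update_self]

theorem measurePreserving_comp_perm (ν : Measure Z) [IsProbabilityMeasure ν] {n : ℕ}
    (π : Equiv.Perm (Fin n)) :
    MeasurePreserving (fun w : Fin n → Z => w ∘ π)
      (Measure.pi fun _ => ν) (Measure.pi fun _ => ν) := by
  have h := measurePreserving_piCongrLeft (fun _ : Fin n => ν) π.symm
  convert h using 1
  funext w j
  have := Equiv.piCongrLeft_apply_apply (fun _ : Fin n => Z) π.symm w (π j)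
  simpa [MeasurableEquiv.coe_piCongrLeft] using this.symm

/-- Moving coordinate `i` to the front: the cycle that makes removing the first coordinate
the same as removing coordinate `i`, without reordering the others. -/
theorem removeNth_zero_comp_cycleRange {n : ℕ} (i : Fin (n + 1)) (w : Fin (n + 1) → Z) :
    (0 : Fin (n + 1)).removeNth (w ∘ i.cycleRange.symm) = i.removeNth w := by
  funext j
  simp [Fin.removeNth, Fin.cycleRange_symm_succ]

/-- The mean absolute change of `f z b` when `b` is replaced by `b'`. -/
noncomputable def meanDist (ν : Measure Z) (f : Z → E → ℝ) (b b' : E) : ℝ :=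
  ∫ z, |f z b - f z b'| ∂ν

variable {ν : Measure Z} [IsProbabilityMeasure ν] {f : Z → E → ℝ} {M : ℝ}

theorem integrable_of_abs_le {A : Type*} [MeasurableSpace A] {m : Measure A} [IsFiniteMeasure m]
    {g : A → ℝ} (hg : Measurable g) {C : ℝ} (h : ∀ a, |g a| ≤ C) : Integrable g m :=
  Integrable.of_bound hg.aestronglyMeasurable C (Eventually.of_forall h)

theorem meanDist_nonneg (b b' : E) : 0 ≤ meanDist ν f b b' :=
  integral_nonneg fun _ => abs_nonneg _

theorem meanDist_comm (b b' : E) : meanDist ν f b b' = meanDist ν f b' b := by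
  simp only [meanDist, abs_sub_comm]

theorem abs_sub_le_two_mul {x y M : ℝ} (hx : |x| ≤ M) (hy : |y| ≤ M) : |x - y| ≤ 2 * M := by
  have := abs_sub x y
  linarith

theorem meanDist_le (hM : ∀ z b, |f z b| ≤ M) (b b' : E) : meanDist ν f b b' ≤ 2 * M := by
  have h : ‖∫ z, |f z b - f z b'| ∂ν‖ ≤ 2 * M * ν.real Set.univ :=
    norm_integral_le_of_norm_le_const (Eventually.of_forall fun z => by
      rw [Real.norm_eq_abs, abs_abs]; exact abs_sub_le_two_mul (hM z b) (hM z b'))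
  simp only [probReal_univ, mul_one] at h
  exact (le_abs_self _).trans h

theorem abs_meanDist_le (hM : ∀ z b, |f z b| ≤ M) (b b' : E) : |meanDist ν f b b'| ≤ 2 * M := by
  rw [abs_of_nonneg (meanDist_nonneg b b')]; exact meanDist_le hM b b'

theorem meanDist_triangle (hf : Measurable (Function.uncurry f)) (hM : ∀ z b, |f z b| ≤ M)
    (a b c : E) : meanDist ν f a c ≤ meanDist ν f a b + meanDist ν f b c := by
  have hm : ∀ b, Measurable fun z => f z b := fun b =>
    hf.comp (by fun_prop : Measurable fun z => (z, b))
  have hi : ∀ b b', Integrable (fun z => |f z b - f z b'|) ν := fun b b' =>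
    integrable_of_abs_le (by have := hm b; have := hm b'; fun_prop) fun z => by
      rw [abs_abs]; exact abs_sub_le_two_mul (hM z b) (hM z b')
  rw [meanDist, meanDist, meanDist, ← integral_add (hi _ _) (hi _ _)]
  exact integral_mono (hi _ _) ((hi _ _).add (hi _ _)) fun z => abs_sub_le _ _ _

theorem measurable_meanDist (hf : Measurable (Function.uncurry f)) {A : Type*} [MeasurableSpace A]
    {g h : A → E} (hg : Measurable g) (hh : Measurable h) :
    Measurable fun a => meanDist ν f (g a) (h a) := by
  have : Measurable fun q : A × Z => |f q.2 (g q.1) - f q.2 (h q.1)| := by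
    have h1 : Measurable fun q : A × Z => f q.2 (g q.1) :=
      hf.comp (measurable_snd.prodMk (hg.comp measurable_fst))
    have h2 : Measurable fun q : A × Z => f q.2 (h q.1) :=
      hf.comp (measurable_snd.prodMk (hh.comp measurable_fst))
    fun_prop
  exact this.stronglyMeasurable.integral_prod_right.measurable

theorem integral_add_four {A : Type*} [MeasurableSpace A] {m : Measure A} {g₁ g₂ g₃ g₄ : A → ℝ}
    (h₁ : Integrable g₁ m) (h₂ : Integrable g₂ m) (h₃ : Integrable g₃ m) (h₄ : Integrable g₄ m) :
    ∫ a, (g₁ a + g₂ a + g₃ a + g₄ a) ∂m =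
      ∫ a, g₁ a ∂m + ∫ a, g₂ a ∂m + ∫ a, g₃ a ∂m + ∫ a, g₄ a ∂m := by
  rw [integral_add (by exact (h₁.add h₂).add h₃) h₄, integral_add (by exact h₁.add h₂) h₃,
    integral_add h₁ h₂]

variable {n : ℕ} {D : (Fin (n + 1) → Z) → E} {D' : (Fin n → Z) → E}

theorem measurable_removeNth (i : Fin (n + 1)) :
    Measurable fun w : Fin (n + 1) → Z => i.removeNth w :=
  measurable_pi_lambda _ fun _ => measurable_pi_apply _

theorem MeasurePreserving.integral_comp_of_measurable {A B : Type*} [MeasurableSpace A]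
    [MeasurableSpace B] {m : Measure A} {m' : Measure B} {T : A → B}
    (hT : MeasurePreserving T m m') {g : B → ℝ} (hg : Measurable g) :
    ∫ a, g (T a) ∂m = ∫ b, g b ∂m' := by
  rw [← hT.map_eq, integral_map hT.measurable.aemeasurable hg.aestronglyMeasurable]

/-- For a symmetric full-sample estimator the mean influence of an observation does not depend on
which observation is left out; the estimator on the reduced sample need not be symmetric. -/
theorem integral_meanDist_removeNth (hDm : Measurable D)
    (hD : ∀ (w : Fin (n + 1) → Z) (π : Equiv.Perm (Fin (n + 1))), D (w ∘ π) = D w)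
    (hD'm : Measurable D') (hf : Measurable (Function.uncurry f)) (i : Fin (n + 1)) :
    ∫ w, meanDist ν f (D w) (D' (i.removeNth w)) ∂(Measure.pi fun _ => ν) =
      ∫ w, meanDist ν f (D w) (D' ((0 : Fin (n + 1)).removeNth w)) ∂(Measure.pi fun _ => ν) := by
  have h := MeasurePreserving.integral_comp_of_measurable
    (measurePreserving_comp_perm ν i.cycleRange.symm)
    (measurable_meanDist (ν := ν) hf hDm (hD'm.comp (measurable_removeNth 0)))
  simpa only [hD, Function.comp_apply, removeNth_zero_comp_cycleRange] using h

/-- Bound for one cross moment of the leave-one-out terms. The observation `i` is replaced by a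
fresh draw `x`; all estimators in play are compared through the full-sample estimators on the two
samples that differ in coordinate `i`. -/
theorem abs_integral_mul_le (hM : ∀ z b, |f z b| ≤ M)
    (hf : Measurable (Function.uncurry f)) (hDm : Measurable D)
    (hD : ∀ (w : Fin (n + 1) → Z) (π : Equiv.Perm (Fin (n + 1))), D (w ∘ π) = D w)
    (hD'm : Measurable D') {i j : Fin (n + 1)} (hij : i ≠ j) :
    |∫ w, f (w i) (D' (i.removeNth w)) * f (w j) (D' (j.removeNth w)) ∂(Measure.pi fun _ => ν)| ≤
      M * ∫ w, |∫ z, f z (D w) ∂ν| ∂(Measure.pi fun _ => ν) +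
      5 * M * ∫ w, meanDist ν f (D w) (D' ((0 : Fin (n + 1)).removeNth w))
        ∂(Measure.pi fun _ => ν) := by
  set μ : Measure (Fin (n + 1) → Z) := Measure.pi fun _ => ν with hμ
  set κ := ∫ w, meanDist ν f (D w) (D' ((0 : Fin (n + 1)).removeNth w)) ∂μ with hκ
  have hκi : ∀ i : Fin (n + 1), ∫ w, meanDist ν f (D w) (D' (i.removeNth w)) ∂μ = κ :=
    integral_meanDist_removeNth hDm hD hD'm hf
  have hMnn : 0 ≤ M := by
    have hne : Nonempty Z := nonempty_of_isProbabilityMeasure ν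
    obtain ⟨z⟩ := hne
    exact (abs_nonneg _).trans (hM z (D fun _ => z))
  have hrm : ∀ k : Fin (n + 1), Measurable fun w : Fin (n + 1) → Z => D' (k.removeNth w) :=
    fun k => hD'm.comp (measurable_removeNth k)
  have hup := measurePreserving_update ν i
  rw [← hμ] at hup
  have hU : Measurable fun q : Z × (Fin (n + 1) → Z) => Function.update q.2 i q.1 := hup.measurable
  -- `a`, `b` are the two original terms, `a'`, `b'` their decoupled versions.
  set a : Z × (Fin (n + 1) → Z) → ℝ := fun q => f q.1 (D' (i.removeNth q.2)) with ha
  set a' : Z × (Fin (n + 1) → Z) → ℝ := fun q => f q.1 (D q.2) with ha'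
  set b : Z × (Fin (n + 1) → Z) → ℝ :=
    fun q => f (q.2 j) (D' (j.removeNth (Function.update q.2 i q.1))) with hb
  set b' : Z × (Fin (n + 1) → Z) → ℝ := fun q => f (q.2 j) (D' (j.removeNth q.2)) with hb'
  have hqj : Measurable fun q : Z × (Fin (n + 1) → Z) => q.2 j :=
    (measurable_pi_apply j).comp measurable_snd
  have ham : Measurable a := hf.comp (measurable_fst.prodMk ((hrm i).comp measurable_snd))
  have ham' : Measurable a' := hf.comp (measurable_fst.prodMk (hDm.comp measurable_snd))
  have hbm : Measurable b := hf.comp (hqj.prodMk ((hrm j).comp hU))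
  have hbm' : Measurable b' := hf.comp (hqj.prodMk ((hrm j).comp measurable_snd))
  have hmd : ∀ {g h : Z × (Fin (n + 1) → Z) → E}, Measurable g → Measurable h →
      Integrable (fun q => meanDist ν f (g q) (h q)) (ν.prod μ) := fun hg hh =>
    integrable_of_abs_le (measurable_meanDist hf hg hh) fun q => abs_meanDist_le hM _ _
  have hmul : ∀ {x y : ℝ}, |x| ≤ M → |y| ≤ M → |x * y| ≤ M * M := fun hx hy => by
    rw [abs_mul]; exact mul_le_mul hx hy (abs_nonneg _) hMnn
  have hstep : ∫ w, f (w i) (D' (i.removeNth w)) * f (w j) (D' (j.removeNth w)) ∂μ =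
      ∫ q, a q * b q ∂(ν.prod μ) := by
    have hg : Measurable fun w : Fin (n + 1) → Z =>
        f (w i) (D' (i.removeNth w)) * f (w j) (D' (j.removeNth w)) :=
      (hf.comp ((measurable_pi_apply i).prodMk (hrm i))).mul
        (hf.comp ((measurable_pi_apply j).prodMk (hrm j)))
    rw [← MeasurePreserving.integral_comp_of_measurable hup hg]
    simp only [ha, hb, removeNth_update_self, Function.update_self, Function.update_of_ne hij.symm]
  have hdec : ∫ q, a q * b q ∂(ν.prod μ) = ∫ q, a' q * b' q ∂(ν.prod μ) +
      ∫ q, (a q - a' q) * b' q ∂(ν.prod μ) + ∫ q, a q * (b q - b' q) ∂(ν.prod μ) := by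
    have i1 : Integrable (fun q => a' q * b' q) (ν.prod μ) :=
      integrable_of_abs_le (ham'.mul hbm') fun q => hmul (hM _ _) (hM _ _)
    have i0 : Integrable (fun q => a q * b' q) (ν.prod μ) :=
      integrable_of_abs_le (ham.mul hbm') fun q => hmul (hM _ _) (hM _ _)
    have i00 : Integrable (fun q => a q * b q) (ν.prod μ) :=
      integrable_of_abs_le (ham.mul hbm) fun q => hmul (hM _ _) (hM _ _)
    simp only [sub_mul, mul_sub]
    rw [integral_sub i0 i1, integral_sub i00 i0]
    ring
  have h1 : |∫ q, a' q * b' q ∂(ν.prod μ)| ≤ M * ∫ w, |∫ z, f z (D w) ∂ν| ∂μ := by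
    have i1 : Integrable (fun q => a' q * b' q) (ν.prod μ) :=
      integrable_of_abs_le (ham'.mul hbm') fun q => hmul (hM _ _) (hM _ _)
    rw [integral_prod_symm _ i1, ← integral_const_mul]
    refine (abs_integral_le_integral_abs).trans ?_
    have hG : Measurable fun w => ∫ z, f z (D w) ∂ν :=
      (hf.comp (measurable_snd.prodMk (hDm.comp measurable_fst)) : Measurable fun q :
        (Fin (n + 1) → Z) × Z => f q.2 (D q.1)).stronglyMeasurable.integral_prod_right'.measurable
    have hGb : ∀ w, |∫ z, f z (D w) ∂ν| ≤ M := fun w => by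
      have : ‖∫ z, f z (D w) ∂ν‖ ≤ M * ν.real Set.univ :=
        norm_integral_le_of_norm_le_const (Eventually.of_forall fun z => hM _ _)
      simpa using this
    have e : ∀ w, ∫ z, a' (z, w) * b' (z, w) ∂ν =
        (∫ z, f z (D w) ∂ν) * f (w j) (D' (j.removeNth w)) := fun w => by
      simp only [ha', hb']; exact integral_mul_const _ _
    simp only [e]
    have hb0 : Measurable fun w : Fin (n + 1) → Z => f (w j) (D' (j.removeNth w)) :=
      hf.comp ((measurable_pi_apply j).prodMk (hrm j))
    refine integral_mono (integrable_of_abs_le (C := M * M) (hG.mul hb0).abs fun w => ?_)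
      ((integrable_of_abs_le (C := M) hG.abs fun w => ?_).const_mul M) fun w => ?_
    · rw [abs_abs]; exact hmul (hGb w) (hM _ _)
    · rw [abs_abs]; exact hGb w
    · simp only [abs_mul]
      rw [mul_comm]
      exact mul_le_mul_of_nonneg_right (hM _ _) (abs_nonneg _)
  have h2 : |∫ q, (a q - a' q) * b' q ∂(ν.prod μ)| ≤ M * κ := by
    refine (abs_integral_le_integral_abs).trans ?_
    have i2 : Integrable (fun q => |a' q - a q|) (ν.prod μ) :=
      integrable_of_abs_le (ham'.sub ham).abs fun q => by
        rw [abs_abs]; exact abs_sub_le_two_mul (hM _ _) (hM _ _)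
    have e : ∫ q, |a' q - a q| ∂(ν.prod μ) = κ := by
      rw [integral_prod_symm _ i2, ← hκi i]; rfl
    rw [← e, ← integral_const_mul]
    refine integral_mono (integrable_of_abs_le (C := 2 * M * M) ((ham.sub ham').mul hbm').abs
      fun q => ?_) (i2.const_mul M) fun q => ?_
    · rw [abs_abs, abs_mul]
      exact mul_le_mul (abs_sub_le_two_mul (hM _ _) (hM _ _)) (hM _ _) (abs_nonneg _) (by linarith)
    · simp only [abs_mul]
      rw [abs_sub_comm, mul_comm]
      exact mul_le_mul_of_nonneg_right (hM _ _) (abs_nonneg _)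
  have h3 : |∫ q, a q * (b q - b' q) ∂(ν.prod μ)| ≤ M * (4 * κ) := by
    refine (abs_integral_le_integral_abs).trans ?_
    have i3 : Integrable (fun q => |b q - b' q|) (ν.prod μ) :=
      integrable_of_abs_le (hbm.sub hbm').abs fun q => by
        rw [abs_abs]; exact abs_sub_le_two_mul (hM _ _) (hM _ _)
    -- Coordinate `j` is redrawn, since neither of the two estimators in `b`, `b'` depends on it.
    have e : ∫ q, |b q - b' q| ∂(ν.prod μ) = ∫ q, meanDist ν f
        (D' (j.removeNth (Function.update q.2 i q.1))) (D' (j.removeNth q.2)) ∂(ν.prod μ) := by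
      have hmp : MeasurePreserving (fun r : Z × (Z × (Fin (n + 1) → Z)) =>
          (r.2.1, Function.update r.2.2 j r.1)) (ν.prod (ν.prod μ)) (ν.prod μ) := by
        have hs : MeasurePreserving (fun r : Z × (Z × (Fin (n + 1) → Z)) =>
            (r.2.1, (r.1, r.2.2))) (ν.prod (ν.prod μ)) (ν.prod (ν.prod μ)) := by
          have h1 := (measurePreserving_prodAssoc ν ν μ).comp
            (((Measure.measurePreserving_swap (μ := ν) (ν := ν)).prod
              (MeasurePreserving.id μ)).comp (measurePreserving_prodAssoc ν ν μ).symm)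
          exact h1
        exact ((MeasurePreserving.id ν).prod (measurePreserving_update ν j)).comp hs
      have hg : Measurable fun q => |b q - b' q| := (hbm.sub hbm').abs
      have i4 : Integrable (fun r : Z × (Z × (Fin (n + 1) → Z)) =>
          (fun q => |b q - b' q|) (r.2.1, Function.update r.2.2 j r.1)) (ν.prod (ν.prod μ)) :=
        integrable_of_abs_le (hg.comp hmp.measurable) fun q => by
          rw [abs_abs]; exact abs_sub_le_two_mul (hM _ _) (hM _ _)
      rw [← MeasurePreserving.integral_comp_of_measurable hmp hg, integral_prod_symm _ i4]
      simp only [hb, hb', Function.update_self, removeNth_update_comm hij, removeNth_update_self]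
      rfl
    -- The two estimators without `j` are compared along the chain: without `j` and full, on the
    -- overwritten sample; without `i`, the same on both samples; full and without `j`, on the
    -- original sample. Each of its four links contributes `κ`.
    have hsum : ∫ q, |b q - b' q| ∂(ν.prod μ) ≤ 4 * κ := by
      have hm1 : Measurable fun q : Z × (Fin (n + 1) → Z) =>
          D' (j.removeNth (Function.update q.2 i q.1)) := (hrm j).comp hU
      have hm2 : Measurable fun q : Z × (Fin (n + 1) → Z) => D (Function.update q.2 i q.1) :=
        hDm.comp hU
      have hm3 : Measurable fun q : Z × (Fin (n + 1) → Z) => D' (i.removeNth q.2) :=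
        (hrm i).comp measurable_snd
      have hm4 : Measurable fun q : Z × (Fin (n + 1) → Z) => D q.2 := hDm.comp measurable_snd
      have hm5 : Measurable fun q : Z × (Fin (n + 1) → Z) => D' (j.removeNth q.2) :=
        (hrm j).comp measurable_snd
      have v1 : ∀ k : Fin (n + 1), ∫ q : Z × (Fin (n + 1) → Z),
          meanDist ν f (D (Function.update q.2 i q.1))
            (D' (k.removeNth (Function.update q.2 i q.1))) ∂(ν.prod μ) = κ := fun k => by
        rw [← hκi k]
        exact MeasurePreserving.integral_comp_of_measurable hup
          (measurable_meanDist (ν := ν) hf hDm (hrm k))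
      have v2 : ∀ k : Fin (n + 1), ∫ q : Z × (Fin (n + 1) → Z),
          meanDist ν f (D q.2) (D' (k.removeNth q.2)) ∂(ν.prod μ) = κ := fun k => by
        rw [← hκi k]
        exact MeasurePreserving.integral_comp_of_measurable
          (measurePreserving_snd (μ := ν) (ν := μ)) (measurable_meanDist (ν := ν) hf hDm (hrm k))
      have v1i := v1 i
      simp only [removeNth_update_self] at v1i
      have t : 4 * κ = ∫ q : Z × (Fin (n + 1) → Z),
          (meanDist ν f (D (Function.update q.2 i q.1))
            (D' (j.removeNth (Function.update q.2 i q.1))) +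
          meanDist ν f (D (Function.update q.2 i q.1)) (D' (i.removeNth q.2)) +
          meanDist ν f (D q.2) (D' (i.removeNth q.2)) +
          meanDist ν f (D q.2) (D' (j.removeNth q.2))) ∂(ν.prod μ) := by
        rw [integral_add_four (hmd hm2 hm1) (hmd hm2 hm3) (hmd hm4 hm3) (hmd hm4 hm5), v1 j, v1i,
          v2 i, v2 j]
        ring
      rw [e, t]
      refine integral_mono (hmd hm1 hm5)
        ((((hmd hm2 hm1).add (hmd hm2 hm3)).add (hmd hm4 hm3)).add (hmd hm4 hm5)) fun q => ?_
      have t1 := meanDist_triangle (ν := ν) hf hM (D' (j.removeNth (Function.update q.2 i q.1)))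
        (D (Function.update q.2 i q.1)) (D' (j.removeNth q.2))
      have t2 := meanDist_triangle (ν := ν) hf hM (D (Function.update q.2 i q.1))
        (D' (i.removeNth q.2)) (D' (j.removeNth q.2))
      have t3 := meanDist_triangle (ν := ν) hf hM (D' (i.removeNth q.2)) (D q.2)
        (D' (j.removeNth q.2))
      rw [meanDist_comm (D' (j.removeNth (Function.update q.2 i q.1)))
        (D (Function.update q.2 i q.1))] at t1
      rw [meanDist_comm (D' (i.removeNth q.2)) (D q.2)] at t3
      linarith
    refine le_trans ?_ (mul_le_mul_of_nonneg_left hsum hMnn)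
    rw [← integral_const_mul]
    refine integral_mono (integrable_of_abs_le (C := M * (2 * M)) (ham.mul (hbm.sub hbm')).abs
      fun q => ?_) (i3.const_mul M) fun q => ?_
    · rw [abs_abs, abs_mul]
      exact mul_le_mul (hM _ _) (abs_sub_le_two_mul (hM _ _) (hM _ _)) (abs_nonneg _) hMnn
    · simp only [abs_mul]
      exact mul_le_mul_of_nonneg_right (hM _ _) (abs_nonneg _)
  rw [hstep, hdec]
  calc _ ≤ _ := abs_add_three _ _ _
    _ ≤ _ := add_le_add_three h1 h2 h3
    _ = _ := by ring

/-- Second-moment bound for an average of leave-one-out terms: it is small as soon as the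
conditional mean of a term given the full-sample estimator is small, and the estimator reacts
little, in mean, to the removal of the first observation. -/
theorem integral_sq_average_le (hM : ∀ z b, |f z b| ≤ M)
    (hf : Measurable (Function.uncurry f)) (hDm : Measurable D)
    (hD : ∀ (w : Fin (n + 1) → Z) (π : Equiv.Perm (Fin (n + 1))), D (w ∘ π) = D w)
    (hD'm : Measurable D') :
    ∫ w, ((∑ i, f (w i) (D' (Fin.removeNth i w))) / (n + 1 : ℝ)) ^ 2 ∂(Measure.pi fun _ => ν) ≤
      M ^ 2 / (n + 1 : ℝ) +
      (M * ∫ w, |∫ z, f z (D w) ∂ν| ∂(Measure.pi fun _ => ν) +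
      5 * M * ∫ w, meanDist ν f (D w) (D' ((0 : Fin (n + 1)).removeNth w))
        ∂(Measure.pi fun _ => ν)) := by
  set μ : Measure (Fin (n + 1) → Z) := Measure.pi fun _ => ν with hμ
  set R := M * ∫ w, |∫ z, f z (D w) ∂ν| ∂μ +
      5 * M * ∫ w, meanDist ν f (D w) (D' ((0 : Fin (n + 1)).removeNth w)) ∂μ with hR
  have hMnn : 0 ≤ M := by
    obtain ⟨z⟩ : Nonempty Z := nonempty_of_isProbabilityMeasure ν
    exact (abs_nonneg _).trans (hM z (D fun _ => z))
  have hR0 : 0 ≤ R := by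
    have h1 : 0 ≤ ∫ w, |∫ z, f z (D w) ∂ν| ∂μ := integral_nonneg fun _ => abs_nonneg _
    have h2 : 0 ≤ ∫ w, meanDist ν f (D w) (D' ((0 : Fin (n + 1)).removeNth w)) ∂μ :=
      integral_nonneg fun _ => meanDist_nonneg _ _
    positivity
  have hm : ∀ i : Fin (n + 1), Measurable fun w : Fin (n + 1) → Z =>
      f (w i) (D' (i.removeNth w)) := fun i =>
    hf.comp ((measurable_pi_apply i).prodMk (hD'm.comp (measurable_removeNth i)))
  have hN : (0 : ℝ) < n + 1 := by positivity
  have hij : ∀ i j : Fin (n + 1), ∫ w, f (w i) (D' (i.removeNth w)) *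
      f (w j) (D' (j.removeNth w)) ∂μ ≤ R + if i = j then M ^ 2 else 0 := fun i j => by
    by_cases h : i = j
    · subst h
      simp only [if_true]
      have : ‖∫ w, f (w i) (D' (i.removeNth w)) * f (w i) (D' (i.removeNth w)) ∂μ‖ ≤
          M ^ 2 * μ.real Set.univ :=
        norm_integral_le_of_norm_le_const (Eventually.of_forall fun w => by
          rw [norm_mul, sq]
          exact mul_le_mul (hM _ _) (hM _ _) (norm_nonneg _) hMnn)
      simp only [probReal_univ, mul_one] at this
      have := (le_abs_self _).trans this
      linarith
    · simp only [h, if_false, add_zero]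
      exact (le_abs_self _).trans (abs_integral_mul_le hM hf hDm hD hD'm h)
  have hint : ∀ i j : Fin (n + 1), Integrable (fun w => f (w i) (D' (i.removeNth w)) *
      f (w j) (D' (j.removeNth w))) μ := fun i j =>
    integrable_of_abs_le (C := M * M) ((hm i).mul (hm j)) fun w => by
      rw [abs_mul]; exact mul_le_mul (hM _ _) (hM _ _) (abs_nonneg _) hMnn
  have key : ∫ w, (∑ i, f (w i) (D' (Fin.removeNth i w))) ^ 2 ∂μ ≤
      (n + 1 : ℝ) ^ 2 * R + (n + 1) * M ^ 2 := by
    have hsq : ∀ w : Fin (n + 1) → Z, (∑ i : Fin (n + 1), f (w i) (D' (i.removeNth w))) ^ 2 =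
        ∑ i : Fin (n + 1), ∑ j : Fin (n + 1),
          f (w i) (D' (i.removeNth w)) * f (w j) (D' (j.removeNth w)) := fun w => by
      rw [sq, Finset.sum_mul_sum]
    simp only [hsq]
    rw [integral_finsetSum Finset.univ
      (fun (i : Fin (n + 1)) _ => integrable_finsetSum _ fun j _ => hint i j)]
    calc _ = ∑ i : Fin (n + 1), ∑ j : Fin (n + 1), ∫ w, f (w i) (D' (i.removeNth w)) *
          f (w j) (D' (j.removeNth w)) ∂μ :=
          Finset.sum_congr rfl fun i _ => integral_finsetSum _ fun j _ => hint i j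
      _ ≤ ∑ i : Fin (n + 1), ∑ j : Fin (n + 1), (R + if i = j then M ^ 2 else 0) :=
          Finset.sum_le_sum fun i _ => Finset.sum_le_sum fun j _ => hij i j
      _ = _ := by
          simp [Finset.sum_add_distrib]
          ring
  simp only [div_pow]
  rw [integral_div, div_le_iff₀ (by positivity)]
  refine key.trans (le_of_eq ?_)
  field_simp
  ring

end Resampling

/-! ### Independence of the observations -/

section Blocks

variable {Ω : Type*} [MeasurableSpace Ω] {P : Measure Ω} [IsProbabilityMeasure P]
  {v : ℕ → ℕ → Ω → ℝ} {l u : ℕ → Ω → ℝ}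

/-- The rows of an independent array are independent. -/
theorem iIndepFun_rows {ι κ : Type*} {X : ι × κ → Ω → ℝ} (hX : ∀ p, Measurable (X p))
    (h : iIndepFun X P) : iIndepFun (fun i ω j => X (i, j) ω) P := by
  have hpm : ∀ p, IsProbabilityMeasure (P.map (X p)) := fun p =>
    Measure.isProbabilityMeasure_map (hX p).aemeasurable
  have hm : ∀ i, Measurable fun ω (j : κ) => X (i, j) ω := fun i =>
    measurable_pi_lambda _ fun j => hX _
  rw [iIndepFun_iff_map_fun_eq_infinitePi_map hm]
  have h1 : ∀ i, P.map (fun ω (j : κ) => X (i, j) ω) =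
      Measure.infinitePi fun j => P.map (X (i, j)) := fun i =>
    (h.precomp (g := fun j : κ => (i, j)) (Prod.mk_right_injective i)).map_fun_eq_infinitePi_map
      fun j => hX _
  simp only [h1]
  rw [← Measure.infinitePi_map_curry (fun i j => P.map (X (i, j)))]
  change _ = (Measure.infinitePi fun p : ι × κ => P.map (X p)).map _
  rw [← h.map_fun_eq_infinitePi_map hX, Measure.map_map (MeasurableEquiv.measurable _)
    (measurable_pi_lambda _ hX)]
  rfl

/-- Where the random variables that make up observation `i` with `k` regressors sit among all
variables: the entries `v_{i1}, …, v_{ik}`, then `l_i` and `u_i`. -/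
def blockIndex (k : ℕ) (q : ℕ × (Fin k ⊕ Bool)) : (ℕ × ℕ) ⊕ (ℕ ⊕ ℕ) :=
  match q.2 with
  | Sum.inl j => Sum.inl (q.1, j + 1)
  | Sum.inr false => Sum.inr (Sum.inl q.1)
  | Sum.inr true => Sum.inr (Sum.inr q.1)

theorem blockIndex_injective (k : ℕ) : Function.Injective (blockIndex k) := by
  rintro ⟨i, (j | (_ | _))⟩ ⟨i', (j' | (_ | _))⟩ h <;> simp [blockIndex] at h ⊢
  · exact ⟨h.1, Fin.ext h.2⟩
  · exact h
  · exact h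

/-- The standardized observation `(l_i (v_{i1}, …, v_{ik})', u_i)`. -/
noncomputable def rawObs (v : ℕ → ℕ → Ω → ℝ) (l u : ℕ → Ω → ℝ) (k i : ℕ) (ω : Ω) :
    EuclideanSpace ℝ (Fin k) × ℝ :=
  (l i ω • WithLp.toLp 2 (fun j : Fin k => v i (j + 1) ω), u i ω)

theorem IsDataModel.measurable_allVars (h : IsDataModel P v l u) (q : (ℕ × ℕ) ⊕ (ℕ ⊕ ℕ)) :
    Measurable (allVars v l u q) := by
  rcases q with q | q | q
  · exact h.meas_v _ _
  · exact h.meas_l _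
  · exact h.meas_u _

/-- An observation as a function of its block of variables. -/
noncomputable def blockObs (k : ℕ) (y : Fin k ⊕ Bool → ℝ) : EuclideanSpace ℝ (Fin k) × ℝ :=
  (y (Sum.inr false) • WithLp.toLp 2 (fun j : Fin k => y (Sum.inl j)), y (Sum.inr true))

theorem measurable_blockObs (k : ℕ) : Measurable (blockObs k) := by
  unfold blockObs
  have : Measurable fun y : Fin k ⊕ Bool → ℝ =>
      (WithLp.toLp 2 (fun j : Fin k => y (Sum.inl j)) : EuclideanSpace ℝ (Fin k)) :=
    (WithLp.measurable_toLp 2 _).comp (by fun_prop)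
  fun_prop

theorem rawObs_eq (k i : ℕ) :
    rawObs v l u k i = blockObs k ∘ fun ω b => allVars v l u (blockIndex k (i, b)) ω := rfl

theorem IsDataModel.measurable_rawObs (h : IsDataModel P v l u) (k i : ℕ) :
    Measurable (rawObs v l u k i) := by
  rw [rawObs_eq]
  exact (measurable_blockObs k).comp (measurable_pi_lambda _ fun b => h.measurable_allVars _)

theorem IsDataModel.iIndepFun_rawObs (h : IsDataModel P v l u) (k : ℕ) :
    iIndepFun (rawObs v l u k) P := by
  have h1 := iIndepFun_rows (fun q => h.measurable_allVars _)
    (h.indep.precomp (blockIndex_injective k))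
  exact h1.comp (fun _ => blockObs k) fun _ => measurable_blockObs k

theorem IsDataModel.map_rawObs (h : IsDataModel P v l u) (k i : ℕ) :
    P.map (rawObs v l u k i) = P.map (rawObs v l u k 0) := by
  have hm : ∀ i, Measurable fun ω (b : Fin k ⊕ Bool) => allVars v l u (blockIndex k (i, b)) ω :=
    fun i => measurable_pi_lambda _ fun b => h.measurable_allVars _
  have key : ∀ i, P.map (fun ω (b : Fin k ⊕ Bool) => allVars v l u (blockIndex k (i, b)) ω) =
      Measure.pi fun b : Fin k ⊕ Bool => P.map (Sum.elim (fun _ => v 0 0)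
        (fun c : Bool => bif c then u 0 else l 0) b) := fun i => by
    have hi := (h.indep.precomp (g := fun b : Fin k ⊕ Bool => blockIndex k (i, b))
      ((blockIndex_injective k).comp (Prod.mk_right_injective i))).map_fun_eq_pi_map
      fun b => (h.measurable_allVars _).aemeasurable
    refine hi.trans (congrArg Measure.pi (funext fun b => ?_))
    rcases b with b | _ | _
    · exact (h.ident_v i (b + 1)).map_eq
    · exact (h.ident_l i).map_eq
    · exact (h.ident_u i).map_eq
  rw [rawObs_eq, rawObs_eq, ← Measure.map_map (measurable_blockObs k) (hm i),
    ← Measure.map_map (measurable_blockObs k) (hm 0), key, key]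

/-- The standardized training sample of size `m`. -/
noncomputable def rawSample (v : ℕ → ℕ → Ω → ℝ) (l u : ℕ → Ω → ℝ) (k m : ℕ) (ω : Ω) :
    Fin m → EuclideanSpace ℝ (Fin k) × ℝ :=
  fun i => rawObs v l u k (i + 1) ω

theorem IsDataModel.isProbabilityMeasure_map_rawObs (h : IsDataModel P v l u) (k i : ℕ) :
    IsProbabilityMeasure (P.map (rawObs v l u k i)) :=
  Measure.isProbabilityMeasure_map (h.measurable_rawObs k i).aemeasurable

theorem IsDataModel.measurable_rawSample (h : IsDataModel P v l u) (k m : ℕ) :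
    Measurable (rawSample v l u k m) :=
  measurable_pi_lambda _ fun _ => h.measurable_rawObs k _

theorem IsDataModel.measurePreserving_rawSample (h : IsDataModel P v l u) (k m : ℕ) :
    MeasurePreserving (rawSample v l u k m) P
      (Measure.pi fun _ => P.map (rawObs v l u k 0)) where
  measurable := h.measurable_rawSample k m
  map_eq := by
    have hinj : Function.Injective fun i : Fin m => (i : ℕ) + 1 := fun i j hij => by
      simpa [Fin.ext_iff] using hij
    have h1 := ((h.iIndepFun_rawObs k).precomp hinj).map_fun_eq_pi_map
      fun i => (h.measurable_rawObs k _).aemeasurable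
    refine h1.trans (congrArg Measure.pi (funext fun i => ?_))
    exact h.map_rawObs k _

/-- The training sample is independent of the observation to be predicted. -/
theorem IsDataModel.indepFun_rawSample_rawObs (h : IsDataModel P v l u) (k m : ℕ) :
    IndepFun (rawSample v l u k m) (rawObs v l u k 0) P := by
  have h1 := (h.iIndepFun_rawObs k).indepFun_finset (Finset.Icc 1 m) {0}
    (by simp) (h.measurable_rawObs k)
  have e1 : rawSample v l u k m = (fun (y : Finset.Icc 1 m → EuclideanSpace ℝ (Fin k) × ℝ)
      (i : Fin m) => y ⟨i + 1, by simp⟩) ∘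
      fun ω (i : Finset.Icc 1 m) => rawObs v l u k i ω := rfl
  have e2 : rawObs v l u k 0 = (fun (y : ({0} : Finset ℕ) → EuclideanSpace ℝ (Fin k) × ℝ) =>
      y ⟨0, by simp⟩) ∘ fun ω (i : ({0} : Finset ℕ)) => rawObs v l u k i ω := rfl
  rw [e1, e2]
  exact h1.comp (measurable_pi_lambda _ fun _ => measurable_pi_apply _) (measurable_pi_apply _)

/-- The pair `(l_0, u_0)` is independent of the entries of `v` in row `0`. -/
theorem IsDataModel.indepFun_lu_v (h : IsDataModel P v l u) (k : ℕ) :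
    IndepFun (fun ω => (l 0 ω, u 0 ω)) (fun ω (j : Fin k) => v 0 (j + 1) ω) P := by
  set e : Fin k ⊕ Bool → (ℕ × ℕ) ⊕ (ℕ ⊕ ℕ) := fun b => blockIndex k (0, b)
  have hi := h.indep.precomp (g := e)
    ((blockIndex_injective k).comp (Prod.mk_right_injective 0))
  set S : Finset (Fin k ⊕ Bool) := Finset.univ.map ⟨Sum.inr, Sum.inr_injective⟩
  set T : Finset (Fin k ⊕ Bool) := Finset.univ.map ⟨Sum.inl, Sum.inl_injective⟩
  have h1 := hi.indepFun_finset S T (by simp [S, T, Finset.disjoint_left])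
    (fun b => h.measurable_allVars _)
  have hφ : Measurable fun y : S → ℝ =>
      (y ⟨Sum.inr false, by simp [S]⟩, y ⟨Sum.inr true, by simp [S]⟩) :=
    (measurable_pi_apply _).prodMk (measurable_pi_apply _)
  have hψ : Measurable fun (y : T → ℝ) (j : Fin k) => y ⟨Sum.inl j, by simp [T]⟩ :=
    measurable_pi_lambda _ fun _ => measurable_pi_apply _
  exact h1.comp hφ hψ

theorem IsDataModel.iIndepFun_row (h : IsDataModel P v l u) (k : ℕ) :
    iIndepFun (fun (j : Fin k) ω => v 0 (j + 1) ω) P :=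
  h.indep.precomp (g := fun j : Fin k => Sum.inl (0, (j : ℕ) + 1)) fun i j hij => by
    simpa [Fin.ext_iff] using hij

end Blocks

/-! ### A central limit theorem for weighted sums -/

section Lindeberg

theorem norm_prod_sub_prod_le {ι : Type*} (s : Finset ι) (a c : ι → ℂ) (ha : ∀ i, ‖a i‖ ≤ 1)
    (hc : ∀ i, ‖c i‖ ≤ 1) : ‖∏ i ∈ s, a i - ∏ i ∈ s, c i‖ ≤ ∑ i ∈ s, ‖a i - c i‖ := by
  classical
  induction s using Finset.induction_on with
  | empty => simp
  | insert i s hi ih =>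
    rw [Finset.prod_insert hi, Finset.prod_insert hi, Finset.sum_insert hi]
    have h1 : ‖∏ j ∈ s, a j‖ ≤ 1 := by
      rw [norm_prod]; exact Finset.prod_le_one (fun _ _ => norm_nonneg _) fun j _ => ha j
    calc ‖a i * ∏ j ∈ s, a j - c i * ∏ j ∈ s, c j‖
        = ‖(a i - c i) * ∏ j ∈ s, a j + c i * (∏ j ∈ s, a j - ∏ j ∈ s, c j)‖ := by ring_nf
      _ ≤ ‖a i - c i‖ * ‖∏ j ∈ s, a j‖ + ‖c i‖ * ‖∏ j ∈ s, a j - ∏ j ∈ s, c j‖ := by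
        rw [← norm_mul, ← norm_mul]; exact norm_add_le _ _
      _ ≤ ‖a i - c i‖ * 1 + 1 * ∑ j ∈ s, ‖a j - c j‖ := by
        gcongr
        exact hc i
      _ = _ := by ring

theorem charFun_stdNormal (t : ℝ) :
    charFun (gaussianReal 0 1) t = Complex.exp (-(t ^ 2 / 2 : ℝ)) := by
  rw [charFun_gaussianReal]; push_cast; congr 1; simp

/-- A standardized law has, up to `o(t²)` at `0`, the characteristic function of the standard
normal law. -/
theorem charFun_sub_stdNormal_isLittleO {m : Measure ℝ} [IsProbabilityMeasure m]
    (h0 : ∫ x, x ∂m = 0) (h1 : ∫ x, x ^ 2 ∂m = 1) :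
    (fun t => charFun m t - charFun (gaussianReal 0 1) t) =o[𝓝 0] fun t : ℝ => t ^ 2 := by
  have a := taylor_charFun_two (P := m) (X := id) aemeasurable_id (by simpa using h0)
    (by simpa using h1)
  have hv : ∫ x, x ^ 2 ∂(gaussianReal 0 1) = 1 := by
    have := variance_eq_sub (X := id) (μ := gaussianReal 0 1) (memLp_id_gaussianReal 2)
    rw [variance_id_gaussianReal] at this
    simpa [integral_id_gaussianReal] using this.symm
  have b := taylor_charFun_two (P := gaussianReal 0 1) (X := id) aemeasurable_id
    (by simp [integral_id_gaussianReal]) (by simpa using hv)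
  have := a.sub b
  simpa using this

/-- Lindeberg's argument: for a standardized law, the product of the characteristic functions of
the weighted terms is asymptotically Gaussian when the largest weight vanishes. -/
theorem tendsto_prod_charFun {m : Measure ℝ} [IsProbabilityMeasure m]
    (h0 : ∫ x, x ∂m = 0) (h1 : ∫ x, x ^ 2 ∂m = 1) {k : ℕ → ℕ}
    (b : (r : ℕ) → EuclideanSpace ℝ (Fin (k r))) {τ : ℝ}
    (hb : Tendsto (fun r => ‖b r‖) atTop (𝓝 τ))
    (hmax : m = gaussianReal 0 1 ∨ ∀ η : ℝ, 0 < η → ∀ᶠ r in atTop, ∀ j, |b r j| ≤ η) (t : ℝ) :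
    Tendsto (fun r => ∏ j, charFun m (b r j * t)) atTop
      (𝓝 (charFun (gaussianReal 0 1) (t * τ))) := by
  have hg : ∀ r, ∏ j, charFun (gaussianReal 0 1) (b r j * t) =
      charFun (gaussianReal 0 1) (t * ‖b r‖) := fun r => by
    simp only [charFun_stdNormal, ← Complex.exp_sum]
    congr 1
    rw [mul_pow, EuclideanSpace.real_norm_sq_eq, Finset.mul_sum, Finset.sum_div]
    push_cast
    rw [← Finset.sum_neg_distrib]
    refine Finset.sum_congr rfl fun j _ => by ring
  have hgt : Tendsto (fun r => charFun (gaussianReal 0 1) (t * ‖b r‖)) atTop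
      (𝓝 (charFun (gaussianReal 0 1) (t * τ))) := by
    have hc : Continuous fun x : ℝ => charFun (gaussianReal 0 1) x := continuous_charFun
    exact (hc.tendsto _).comp (hb.const_mul t)
  rcases hmax with rfl | hmax
  · simpa only [hg] using hgt
  have hd : Tendsto (fun r => ∏ j, charFun m (b r j * t) -
      charFun (gaussianReal 0 1) (t * ‖b r‖)) atTop (𝓝 0) := by
    rw [Metric.tendsto_nhds]
    intro ε hε
    obtain ⟨C, hC⟩ : ∃ C : ℝ, ∀ᶠ r in atTop, ‖b r‖ ^ 2 ≤ C :=
      ⟨τ ^ 2 + 1, ((hb.pow 2).eventually (ge_mem_nhds (lt_add_one _)))⟩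
    set η := ε / (2 * (t ^ 2 * |C| + 1)) with hη
    have hη0 : 0 < η := by positivity
    obtain ⟨δ, hδ, hδ'⟩ := Metric.eventually_nhds_iff.1
      ((charFun_sub_stdNormal_isLittleO h0 h1).bound hη0)
    filter_upwards [hC, hmax (δ / (2 * (|t| + 1))) (by positivity)] with r hr hj
    rw [dist_zero_right, ← hg]
    calc _ ≤ ∑ j, ‖charFun m (b r j * t) - charFun (gaussianReal 0 1) (b r j * t)‖ :=
          norm_prod_sub_prod_le _ _ _ (fun _ => norm_charFun_le_one _)
            fun _ => norm_charFun_le_one _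
      _ ≤ ∑ j, η * (b r j * t) ^ 2 := by
          refine Finset.sum_le_sum fun j _ => ?_
          have hs : dist (b r j * t) 0 < δ := by
            rw [dist_zero_right, norm_mul, Real.norm_eq_abs, Real.norm_eq_abs]
            calc |b r j| * |t| ≤ δ / (2 * (|t| + 1)) * |t| := by gcongr; exact hj j
              _ < δ := by
                rw [div_mul_eq_mul_div, div_lt_iff₀ (by positivity)]
                nlinarith [abs_nonneg t]
          have := hδ' hs
          rwa [Real.norm_of_nonneg (sq_nonneg _)] at this
      _ = η * (t ^ 2 * ‖b r‖ ^ 2) := by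
          rw [EuclideanSpace.real_norm_sq_eq, Finset.mul_sum, Finset.mul_sum]
          exact Finset.sum_congr rfl fun j _ => by ring
      _ ≤ η * (t ^ 2 * |C| + 1) := by
          gcongr
          have : t ^ 2 * ‖b r‖ ^ 2 ≤ t ^ 2 * |C| := by gcongr; exact hr.trans (le_abs_self _)
          linarith
      _ = ε / 2 := by rw [hη]; field_simp
      _ < ε := by linarith
  simpa using hd.add hgt

end Lindeberg

/-! ### The law of the standardized prediction error -/

section PredictionError

variable {Ω : Type*} [MeasurableSpace Ω] {P : Measure Ω} [IsProbabilityMeasure P]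
  {v : ℕ → ℕ → Ω → ℝ} {l u : ℕ → Ω → ℝ}

/-- The standardized error made when the response of the standardized observation `z` is predicted
with an estimate whose standardized error is `b`. -/
noncomputable def predError {k : ℕ} (z : EuclideanSpace ℝ (Fin k) × ℝ)
    (b : EuclideanSpace ℝ (Fin k)) : ℝ :=
  z.2 - ⟪z.1, b⟫

theorem continuous_predError {k : ℕ} : Continuous (Function.uncurry (predError (k := k))) := by
  unfold predError Function.uncurry
  fun_prop

theorem measurable_predError {k : ℕ} : Measurable (Function.uncurry (predError (k := k))) :=
  continuous_predError.measurable

theorem inner_rawObs {k : ℕ} (i : ℕ) (b : EuclideanSpace ℝ (Fin k)) (ω : Ω) :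
    ⟪(rawObs v l u k i ω).1, b⟫ = l i ω * ∑ j : Fin k, b j * v i (j + 1) ω := by
  simp only [rawObs, PiLp.inner_apply, PiLp.smul_apply, smul_eq_mul, Finset.mul_sum,
    RCLike.inner_apply, conj_trivial]
  exact Finset.sum_congr rfl fun j _ => by ring

theorem measurable_weightedSum {k : ℕ} (b : EuclideanSpace ℝ (Fin k)) :
    Measurable fun y : Fin k → ℝ => ∑ j : Fin k, b j * y j := by fun_prop

theorem IsDataModel.memLp_v (h : IsDataModel P v l u) (i j : ℕ) : MemLp (v i j) 2 P := by
  have h0 : MemLp (v 0 0) 2 P := h.fourth_v.mono_exponent (by norm_num)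
  exact (h.ident_v i j).symm.memLp_iff.1 h0

theorem IsDataModel.integral_sq_weightedSum (h : IsDataModel P v l u) {k : ℕ}
    (b : EuclideanSpace ℝ (Fin k)) :
    MemLp (fun ω => ∑ j : Fin k, b j * v 0 (j + 1) ω) 2 P ∧
    ∫ ω, (∑ j : Fin k, b j * v 0 (j + 1) ω) ^ 2 ∂P = ‖b‖ ^ 2 := by
  have hL : ∀ j : Fin k, MemLp (fun ω => b j * v 0 (j + 1) ω) 2 P := fun j =>
    (h.memLp_v 0 (j + 1)).const_mul _
  have hS : MemLp (fun ω => ∑ j : Fin k, b j * v 0 (j + 1) ω) 2 P :=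
    memLp_finsetSum _ fun j _ => hL j
  refine ⟨hS, ?_⟩
  have hmean : ∀ j : Fin k, ∫ ω, b j * v 0 (j + 1) ω ∂P = 0 := fun j => by
    rw [integral_const_mul, (h.ident_v 0 (j + 1)).integral_eq, h.mean_v, mul_zero]
  have hvar : ∀ j : Fin k, Var[fun ω => b j * v 0 (j + 1) ω; P] = b j ^ 2 := fun j => by
    rw [variance_const_mul, (h.ident_v 0 (j + 1)).variance_eq,
      variance_eq_sub (h.memLp_v 0 0), h.mean_v]
    have := h.var_v
    simp only [Pi.pow_apply] at this ⊢
    rw [this]; ring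
  have h1 := IndepFun.variance_sum (s := Finset.univ) (μ := P)
    (X := fun (j : Fin k) ω => b j * v 0 (j + 1) ω) (fun j _ => hL j) fun i _ j _ hij => by
      exact ((h.iIndepFun_row k).indepFun hij).comp (φ := fun x => b i * x)
        (ψ := fun x => b j * x) (by fun_prop) (by fun_prop)
  have e : (∑ j : Fin k, fun ω => b j * v 0 (j + 1) ω) =
      fun ω => ∑ j : Fin k, b j * v 0 (j + 1) ω := by ext ω; simp
  rw [e, variance_eq_sub hS, integral_finsetSum _ fun j _ => (hL j).integrable (by norm_num)]
    at h1
  simp only [hmean, hvar] at h1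
  rw [EuclideanSpace.real_norm_sq_eq, ← h1]
  simp

theorem integral_abs_le_of_sq {A : Type*} [MeasurableSpace A] {m : Measure A}
    [IsProbabilityMeasure m] {g : A → ℝ} (hg : MemLp g 2 m) {C : ℝ} (hC : 0 ≤ C)
    (h : ∫ a, g a ^ 2 ∂m = C ^ 2) : ∫ a, |g a| ∂m ≤ C := by
  have h1 := variance_nonneg (fun a => |g a|) m
  rw [variance_eq_sub (X := fun a => |g a|) hg.abs] at h1
  simp only [Pi.pow_apply, sq_abs, h] at h1
  exact abs_le_of_sq_le_sq' (by linarith) hC |>.2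

/-- Since `E[x x'] = I` for a standardized regressor `x`, a linear form in `x` is bounded in mean
by the norm of its coefficients. -/
theorem IsDataModel.integral_abs_inner_le (h : IsDataModel P v l u) {k : ℕ}
    (b : EuclideanSpace ℝ (Fin k)) :
    Integrable (fun ω => ⟪(rawObs v l u k 0 ω).1, b⟫) P ∧
    ∫ ω, |⟪(rawObs v l u k 0 ω).1, b⟫| ∂P ≤ ‖b‖ := by
  obtain ⟨hS, hS2⟩ := h.integral_sq_weightedSum b
  have hl : MemLp (l 0) 2 P := (memLp_two_iff_integrable_sq (h.meas_l 0).aestronglyMeasurable).2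
    (.of_integral_ne_zero (by rw [h.second_l]; exact one_ne_zero))
  have hind : IndepFun (l 0) (fun ω => ∑ j : Fin k, b j * v 0 (j + 1) ω) P :=
    (h.indepFun_lu_v k).comp measurable_fst (measurable_weightedSum b)
  simp only [inner_rawObs]
  refine ⟨hind.integrable_mul (hl.integrable (by norm_num)) (hS.integrable (by norm_num)), ?_⟩
  have h2 := (hind.comp (φ := fun x => |x|) (ψ := fun x => |x|) (by fun_prop)
    (by fun_prop)).integral_fun_mul_eq_mul_integral (hl.abs.aestronglyMeasurable)
    (hS.abs.aestronglyMeasurable)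
  simp only [Function.comp_apply] at h2
  simp only [abs_mul]
  rw [h2]
  calc _ ≤ 1 * ‖b‖ := by
        refine mul_le_mul (integral_abs_le_of_sq hl zero_le_one (by rw [h.second_l]; norm_num))
          (integral_abs_le_of_sq hS (norm_nonneg _) hS2) (integral_nonneg fun _ => abs_nonneg _)
          zero_le_one
    _ = ‖b‖ := one_mul _

/-- A bounded Lipschitz function of the prediction error changes little, in mean, when the
estimate changes little. -/
theorem IsDataModel.meanDist_predError_le (h : IsDataModel P v l u) {k : ℕ} {φ : ℝ → ℝ}
    {K : NNReal} (hφ : LipschitzWith K φ) {M : ℝ} (hM : ∀ x, |φ x| ≤ M)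
    (b b' : EuclideanSpace ℝ (Fin k)) :
    meanDist (P.map (rawObs v l u k 0)) (fun z b => φ (predError z b)) b b' ≤ K * ‖b - b'‖ := by
  have hm : ∀ b : EuclideanSpace ℝ (Fin k), Measurable fun z : EuclideanSpace ℝ (Fin k) × ℝ =>
      φ (predError z b) := fun b => hφ.continuous.measurable.comp
        (measurable_predError.comp (by fun_prop : Measurable fun z => (z, b)))
  have hr := h.measurable_rawObs k 0
  have hd : Measurable fun z : EuclideanSpace ℝ (Fin k) × ℝ =>
      |φ (predError z b) - φ (predError z b')| := ((hm b).sub (hm b')).abs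
  rw [meanDist, integral_map hr.aemeasurable hd.aestronglyMeasurable]
  obtain ⟨hi, hle⟩ := h.integral_abs_inner_le (b - b')
  calc ∫ ω, |φ (predError (rawObs v l u k 0 ω) b) - φ (predError (rawObs v l u k 0 ω) b')| ∂P
      ≤ ∫ ω, K * |⟪(rawObs v l u k 0 ω).1, b - b'⟫| ∂P := by
        refine integral_mono (integrable_of_abs_le (C := 2 * M)
          (hd.comp hr) fun ω => ?_) (hi.abs.const_mul _) fun ω => ?_
        · simp only [abs_abs]
          exact abs_sub_le_two_mul (hM _) (hM _)
        · have := hφ.dist_le_mul (predError (rawObs v l u k 0 ω) b)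
            (predError (rawObs v l u k 0 ω) b')
          rw [Real.dist_eq, Real.dist_eq] at this
          refine this.trans (le_of_eq ?_)
          rw [inner_sub_right, ← abs_neg]
          simp only [predError]
          congr 2; ring
    _ ≤ K * ‖b - b'‖ := by
        rw [integral_const_mul]
        exact mul_le_mul_of_nonneg_left hle K.2

theorem IsDataModel.charFun_predError (h : IsDataModel P v l u) {k : ℕ}
    (b : EuclideanSpace ℝ (Fin k)) (s : ℝ) :
    charFun (P.map fun ω => predError (rawObs v l u k 0 ω) b) s =
      ∫ q : ℝ × ℝ, Complex.exp (s * q.2 * Complex.I) *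
        ∏ j, charFun (P.map (v 0 0)) (b j * (-(s * q.1))) ∂(P.map fun ω => (l 0 ω, u 0 ω)) := by
  have hlu : Measurable fun ω => (l 0 ω, u 0 ω) := (h.meas_l 0).prodMk (h.meas_u 0)
  have hv : Measurable fun ω (j : Fin k) => v 0 (j + 1) ω :=
    measurable_pi_lambda _ fun j => h.meas_v _ _
  set W : Ω → ℝ := fun ω => ∑ j : Fin k, b j * v 0 (j + 1) ω with hW
  have hWm : Measurable W := (measurable_weightedSum b).comp hv
  have hind : IndepFun (fun ω => (l 0 ω, u 0 ω)) W P :=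
    (h.indepFun_lu_v k).comp measurable_id (measurable_weightedSum b)
  have hpr : IsProbabilityMeasure (P.map fun ω => (l 0 ω, u 0 ω)) :=
    Measure.isProbabilityMeasure_map hlu.aemeasurable
  have hpW : IsProbabilityMeasure (P.map W) := Measure.isProbabilityMeasure_map hWm.aemeasurable
  have hcW : ∀ t : ℝ, charFun (P.map W) t = ∏ j, charFun (P.map (v 0 0)) (b j * t) := fun t => by
    have h1 := iIndepFun.charFun_map_fun_sum_eq_prod (P := P)
      (X := fun (j : Fin k) ω => b j * v 0 (j + 1) ω)
      (fun j => ((h.meas_v _ _).const_mul _).aemeasurable)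
      ((h.iIndepFun_row k).comp (fun j x => b j * x) fun j => by fun_prop)
    rw [hW, h1, Finset.prod_apply]
    refine Finset.prod_congr rfl fun j _ => ?_
    rw [charFun_map_mul_comp (h.meas_v _ _).aemeasurable, (h.ident_v 0 (j + 1)).map_eq]
  have hem : Measurable fun r : (ℝ × ℝ) × ℝ =>
      Complex.exp (s * (r.1.2 - r.1.1 * r.2 : ℝ) * Complex.I) := by fun_prop
  have hpe : Measurable fun ω => predError (rawObs v l u k 0 ω) b :=
    measurable_predError.comp ((h.measurable_rawObs k 0).prodMk measurable_const)
  rw [charFun_apply_real, integral_map hpe.aemeasurable (by fun_prop)]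
  have e : ∀ ω, predError (rawObs v l u k 0 ω) b = u 0 ω - l 0 ω * W ω := fun ω => by
    rw [predError, inner_rawObs]; rfl
  simp only [e]
  have h2 := integral_map (μ := P) (φ := fun ω => ((l 0 ω, u 0 ω), W ω))
    (hlu.prodMk hWm).aemeasurable hem.aestronglyMeasurable
  rw [hind.map_prod_eq_prod_map_map hlu.aemeasurable hWm.aemeasurable] at h2
  rw [← h2, integral_prod]
  · refine integral_congr_ae (Eventually.of_forall fun q => ?_)
    simp only
    rw [← hcW, charFun_apply_real, ← integral_const_mul]
    refine integral_congr_ae (Eventually.of_forall fun w => ?_)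
    simp only
    rw [← Complex.exp_add]
    congr 1; push_cast; ring
  · refine Integrable.of_bound hem.aestronglyMeasurable 1 (Eventually.of_forall fun r => ?_)
    rw [← Complex.ofReal_mul, Complex.norm_exp_ofReal_mul_I]

theorem IsDataModel.isProbabilityMeasure_limitLaw (h : IsDataModel P v l u) (τ : ℝ) :
    IsProbabilityMeasure (limitLaw P l u τ) := by
  have : IsProbabilityMeasure (P.map fun ω => (l 0 ω, u 0 ω)) :=
    Measure.isProbabilityMeasure_map ((h.meas_l 0).prodMk (h.meas_u 0)).aemeasurable
  exact Measure.isProbabilityMeasure_map (by fun_prop)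

theorem IsDataModel.charFun_limitLaw (h : IsDataModel P v l u) (τ s : ℝ) :
    charFun (limitLaw P l u τ) s =
      ∫ q : ℝ × ℝ, Complex.exp (s * q.2 * Complex.I) *
        charFun (gaussianReal 0 1) (-(s * q.1) * τ) ∂(P.map fun ω => (l 0 ω, u 0 ω)) := by
  have hpr : IsProbabilityMeasure (P.map fun ω => (l 0 ω, u 0 ω)) :=
    Measure.isProbabilityMeasure_map ((h.meas_l 0).prodMk (h.meas_u 0)).aemeasurable
  rw [charFun_apply_real, limitLaw, integral_map (by fun_prop) (by fun_prop), integral_prod]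
  · refine integral_congr_ae (Eventually.of_forall fun q => ?_)
    have : charFun (gaussianReal 0 1) (-(s * q.1) * τ) =
        charFun (gaussianReal 0 1) (s * q.1 * τ) := by
      rw [charFun_stdNormal, charFun_stdNormal]; ring_nf
    simp only
    rw [this, charFun_apply_real, ← integral_const_mul]
    refine integral_congr_ae (Eventually.of_forall fun w => ?_)
    simp only
    rw [← Complex.exp_add]
    congr 1; push_cast; ring
  · refine Integrable.of_bound (by fun_prop) 1 (Eventually.of_forall fun r => ?_)
    rw [← Complex.ofReal_mul, Complex.norm_exp_ofReal_mul_I]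

/-- The prediction error converges in law when the norm of the (deterministic) error of the
estimate tends to `τ` and either the design is Gaussian or the coordinates of the error vanish
uniformly. -/
theorem IsDataModel.tendsto_integral_predError (h : IsDataModel P v l u) {k : ℕ → ℕ}
    (b : (r : ℕ) → EuclideanSpace ℝ (Fin (k r))) {τ : ℝ}
    (hb : Tendsto (fun r => ‖b r‖) atTop (𝓝 τ))
    (hmax : P.map (v 0 0) = gaussianReal 0 1 ∨
      ∀ η : ℝ, 0 < η → ∀ᶠ r in atTop, ∀ j, |b r j| ≤ η)
    (φ : BoundedContinuousFunction ℝ ℝ) :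
    Tendsto (fun r => ∫ ω, φ (predError (rawObs v l u (k r) 0 ω) (b r)) ∂P) atTop
      (𝓝 (∫ x, φ x ∂(limitLaw P l u τ))) := by
  have hpr : IsProbabilityMeasure (P.map fun ω => (l 0 ω, u 0 ω)) :=
    Measure.isProbabilityMeasure_map ((h.meas_l 0).prodMk (h.meas_u 0)).aemeasurable
  have hpv : IsProbabilityMeasure (P.map (v 0 0)) :=
    Measure.isProbabilityMeasure_map (h.meas_v 0 0).aemeasurable
  have hm : ∀ r, Measurable fun ω => predError (rawObs v l u (k r) 0 ω) (b r) := fun r =>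
    measurable_predError.comp ((h.measurable_rawObs (k r) 0).prodMk measurable_const)
  let μs : ℕ → ProbabilityMeasure ℝ := fun r =>
    ⟨P.map fun ω => predError (rawObs v l u (k r) 0 ω) (b r),
      Measure.isProbabilityMeasure_map (hm r).aemeasurable⟩
  let μ₀ : ProbabilityMeasure ℝ := ⟨limitLaw P l u τ, h.isProbabilityMeasure_limitLaw τ⟩
  have h0 : ∫ x, x ∂(P.map (v 0 0)) = 0 := by
    rw [integral_map (h.meas_v 0 0).aemeasurable (by fun_prop)]; exact h.mean_v
  have h1 : ∫ x, x ^ 2 ∂(P.map (v 0 0)) = 1 := by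
    rw [integral_map (h.meas_v 0 0).aemeasurable (by fun_prop)]; exact h.var_v
  have key : Tendsto μs atTop (𝓝 μ₀) := by
    refine ProbabilityMeasure.tendsto_of_tendsto_charFun fun s => ?_
    change Tendsto (fun r => charFun (P.map fun ω => predError (rawObs v l u (k r) 0 ω) (b r)) s)
      atTop (𝓝 (charFun (limitLaw P l u τ) s))
    simp only [h.charFun_predError, h.charFun_limitLaw]
    have hcm : Measurable fun x : ℝ => charFun (P.map (v 0 0)) x := continuous_charFun.measurable
    refine tendsto_integral_of_dominated_convergence (fun _ => 1) (fun r => ?_)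
      (integrable_const _) (fun r => Eventually.of_forall fun q => ?_)
      (Eventually.of_forall fun q => ?_)
    · have : Measurable fun q : ℝ × ℝ => Complex.exp (s * q.2 * Complex.I) *
          ∏ j, charFun (P.map (v 0 0)) (b r j * (-(s * q.1))) := by
        refine Measurable.mul (by fun_prop) (Finset.measurable_fun_prod _ fun j _ =>
          hcm.comp (by fun_prop))
      exact this.aestronglyMeasurable
    · rw [norm_mul, ← Complex.ofReal_mul, Complex.norm_exp_ofReal_mul_I, one_mul, norm_prod]
      exact Finset.prod_le_one (fun _ _ => norm_nonneg _) fun _ _ => norm_charFun_le_one _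
    · exact (tendsto_prod_charFun h0 h1 b hb hmax _).const_mul _
  have := ProbabilityMeasure.tendsto_iff_forall_integral_tendsto.1 key φ
  refine (this.congr fun r => ?_)
  change ∫ x, φ x ∂(P.map _) = _
  rw [integral_map (hm r).aemeasurable (by fun_prop)]

/-- Uniform version of `IsDataModel.tendsto_integral_predError`: one neighbourhood serves all
dimensions. -/
theorem IsDataModel.exists_abs_integral_predError_sub_le (h : IsDataModel P v l u) (τ : ℝ)
    (φ : BoundedContinuousFunction ℝ ℝ) {ε : ℝ} (hε : 0 < ε) :
    ∃ η : ℝ, 0 < η ∧ ∀ (k : ℕ) (b : EuclideanSpace ℝ (Fin k)), |‖b‖ - τ| ≤ η →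
      (P.map (v 0 0) = gaussianReal 0 1 ∨ ∀ j, |b j| ≤ η) →
      |∫ ω, φ (predError (rawObs v l u k 0 ω) b) ∂P - ∫ x, φ x ∂(limitLaw P l u τ)| ≤ ε := by
  by_contra! hcon
  have hpos : ∀ r : ℕ, (0 : ℝ) < 1 / ((r : ℝ) + 1) := fun r => by positivity
  choose k b h1 h2 h3 using fun r : ℕ => hcon (1 / ((r : ℝ) + 1)) (hpos r)
  have hz := tendsto_one_div_add_atTop_nhds_zero_nat (𝕜 := ℝ)
  have hb : Tendsto (fun r => ‖b r‖) atTop (𝓝 τ) := by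
    rw [tendsto_iff_dist_tendsto_zero]
    exact squeeze_zero (fun _ => dist_nonneg) (fun r => by rw [Real.dist_eq]; exact h1 r) hz
  have hmax : P.map (v 0 0) = gaussianReal 0 1 ∨
      ∀ η : ℝ, 0 < η → ∀ᶠ r in atTop, ∀ j, |b r j| ≤ η := by
    by_cases hG : P.map (v 0 0) = gaussianReal 0 1
    · exact Or.inl hG
    · refine Or.inr fun η hη => ?_
      filter_upwards [hz.eventually (ge_mem_nhds hη)] with r hr j
      exact ((h2 r).resolve_left hG j).trans hr
  have hlim := h.tendsto_integral_predError b hb hmax φ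
  have := (tendsto_iff_dist_tendsto_zero.1 hlim).eventually (gt_mem_nhds hε)
  obtain ⟨r, hr⟩ := this.exists
  rw [Real.dist_eq] at hr
  exact absurd (h3 r) (not_lt.2 hr.le)

end PredictionError

/-! ### The limit law -/

section LimitLaw

variable {Ω : Type*} [MeasurableSpace Ω] {P : Measure Ω} [IsProbabilityMeasure P]
  {v : ℕ → ℕ → Ω → ℝ} {l u : ℕ → Ω → ℝ}

theorem continuous_cdf_of_singleton {m : Measure ℝ} [IsProbabilityMeasure m]
    (h : ∀ t, m {t} = 0) : Continuous (cdf m) := by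
  refine continuous_iff_continuousAt.2 fun t => ?_
  rw [continuousAt_iff_continuous_left'_right']
  refine ⟨?_, ((cdf m).right_continuous t).mono Set.Ioi_subset_Ici_self⟩
  rw [(monotone_cdf m).continuousWithinAt_Iio_iff_leftLim_eq]
  have h1 := (cdf m).measure_singleton t
  rw [measure_cdf, h t] at h1
  have h2 := ENNReal.ofReal_eq_zero.1 h1.symm
  exact le_antisymm ((monotone_cdf m).leftLim_le le_rfl) (by linarith)

theorem strictMono_cdf_of_Ioc {m : Measure ℝ} [IsProbabilityMeasure m]
    (h : ∀ s t, s < t → m (Set.Ioc s t) ≠ 0) : StrictMono (cdf m) := fun s t hst => by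
  have h1 := (cdf m).measure_Ioc s t
  rw [measure_cdf] at h1
  by_contra hle
  exact h s t hst (by rw [h1, ENNReal.ofReal_eq_zero]; linarith)

theorem quantile_spec {m : Measure ℝ} [IsProbabilityMeasure m] (hc : Continuous (cdf m)) {a : ℝ}
    (h0 : 0 < a) (h1 : a < 1) : cdf m (quantile m a) = a := by
  have hlow : ∃ t, cdf m t < a := ((tendsto_cdf_atBot m).eventually (gt_mem_nhds h0)).exists
  have hup : ∃ t, a < cdf m t := ((tendsto_cdf_atTop m).eventually (lt_mem_nhds h1)).exists
  obtain ⟨s, hs⟩ := hlow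
  obtain ⟨t, ht⟩ := hup
  have hbdd : BddBelow {t : ℝ | a ≤ cdf m t} := ⟨s, fun x hx => by
    by_contra hlt
    exact absurd (monotone_cdf m (not_le.1 hlt).le) (not_le.2 (hs.trans_le hx))⟩
  have hcl : IsClosed {t : ℝ | a ≤ cdf m t} := isClosed_le continuous_const hc
  refine le_antisymm ?_ (hcl.csInf_mem ⟨t, ht.le⟩ hbdd)
  by_contra hgt
  have hev := (hc.tendsto (quantile m a)).eventually (lt_mem_nhds (not_le.1 hgt))
  obtain ⟨δ, hδ, hδ'⟩ := Metric.eventually_nhds_iff.1 hev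
  have hx : a < cdf m (quantile m a - δ / 2) := hδ' (by
    rw [Real.dist_eq, show quantile m a - δ / 2 - quantile m a = -(δ / 2) by ring, abs_neg,
      abs_of_pos (by positivity)]
    linarith)
  have : quantile m a ≤ quantile m a - δ / 2 := csInf_le hbdd hx.le
  linarith

theorem IsDataModel.ae_ne_zero (h : IsDataModel P v l u) :
    ∀ᵐ q ∂(P.map fun ω => (l 0 ω, u 0 ω)), q.1 ≠ 0 := by
  have hlu : Measurable fun ω => (l 0 ω, u 0 ω) := (h.meas_l 0).prodMk (h.meas_u 0)
  have hs : MeasurableSet {q : ℝ × ℝ | q.1 ≠ 0} :=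
    measurable_fst (measurableSet_singleton (0 : ℝ)).compl
  rw [ae_map_iff hlu.aemeasurable hs]
  obtain ⟨c, hc, hl⟩ := h.lower_l
  filter_upwards [hl] with ω hω h0
  have h0 : l 0 ω = 0 := h0
  rw [h0, abs_zero] at hω
  linarith

theorem IsDataModel.continuous_cdf_limitLaw (h : IsDataModel P v l u) {τ : ℝ} (hτ : 0 < τ) :
    Continuous (cdf (limitLaw P l u τ)) := by
  have := h.isProbabilityMeasure_limitLaw τ
  refine continuous_cdf_of_singleton fun t => ?_
  rw [limitLaw, Measure.map_apply (by fun_prop) (measurableSet_singleton t),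
    Measure.measure_prod_null ((by fun_prop : Measurable fun z : (ℝ × ℝ) × ℝ =>
      z.1.1 * z.2 * τ + z.1.2) (measurableSet_singleton t))]
  filter_upwards [h.ae_ne_zero] with q hq
  have hna : NullSingletonClass (gaussianReal 0 1) := nullSingletonClass_gaussianReal one_ne_zero
  refine Set.Subsingleton.measure_zero (fun x hx y hy => ?_) _
  simp only [Set.mem_preimage, Set.mem_singleton_iff] at hx hy
  have : q.1 * τ * (x - y) = 0 := by linear_combination hx - hy
  rcases mul_eq_zero.1 this with h1 | h1
  · exact absurd h1 (mul_ne_zero hq hτ.ne')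
  · linarith

theorem IsDataModel.strictMono_cdf_limitLaw (h : IsDataModel P v l u) {τ : ℝ} (hτ : 0 < τ) :
    StrictMono (cdf (limitLaw P l u τ)) := by
  have := h.isProbabilityMeasure_limitLaw τ
  have hlu : Measurable fun ω => (l 0 ω, u 0 ω) := (h.meas_l 0).prodMk (h.meas_u 0)
  have hpr : IsProbabilityMeasure (P.map fun ω => (l 0 ω, u 0 ω)) :=
    Measure.isProbabilityMeasure_map hlu.aemeasurable
  refine strictMono_cdf_of_Ioc fun s t hst h0 => ?_
  rw [limitLaw, Measure.map_apply (by fun_prop) measurableSet_Ioc,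
    Measure.measure_prod_null ((by fun_prop : Measurable fun z : (ℝ × ℝ) × ℝ =>
      z.1.1 * z.2 * τ + z.1.2) measurableSet_Ioc)] at h0
  obtain ⟨q, hq, hq0⟩ := (h.ae_ne_zero.and h0).exists
  have hvol := gaussianReal_absolutelyContinuous' 0 one_ne_zero hq0
  have hop : IsOpen ((fun w : ℝ => q.1 * w * τ + q.2) ⁻¹' Set.Ioo s t) :=
    isOpen_Ioo.preimage (by fun_prop)
  have hne : ((fun w : ℝ => q.1 * w * τ + q.2) ⁻¹' Set.Ioo s t).Nonempty := by
    refine ⟨((s + t) / 2 - q.2) / (q.1 * τ), ?_⟩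
    have e : q.1 * (((s + t) / 2 - q.2) / (q.1 * τ)) * τ + q.2 = (s + t) / 2 := by
      field_simp; ring
    simp only [Set.mem_preimage, e, Set.mem_Ioo]
    constructor <;> linarith
  refine (hop.measure_pos volume hne).ne' (measure_mono_null (fun w hw => ?_) hvol)
  exact Set.Ioo_subset_Ioc_self hw

theorem IsDataModel.limitLaw_zero (h : IsDataModel P v l u) :
    limitLaw P l u 0 = P.map (u 0) := by
  have hlu : Measurable fun ω => (l 0 ω, u 0 ω) := (h.meas_l 0).prodMk (h.meas_u 0)
  have hpr : IsProbabilityMeasure (P.map fun ω => (l 0 ω, u 0 ω)) :=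
    Measure.isProbabilityMeasure_map hlu.aemeasurable
  have e : (fun z : (ℝ × ℝ) × ℝ => z.1.1 * z.2 * 0 + z.1.2) = Prod.snd ∘ Prod.fst := by
    funext z; simp
  rw [limitLaw, e, ← Measure.map_map measurable_snd measurable_fst, Measure.map_fst_prod,
    measure_univ, one_smul, Measure.map_map measurable_snd hlu]
  rfl

end LimitLaw

/-! ### Convergence in probability of distribution functions and quantiles -/

section InProbability

variable {Ω : Type*} [MeasurableSpace Ω] {P : Measure Ω}

theorem tendsto_measure_of_subset_union {A B C : ℕ → Set Ω} (h : ∀ n, A n ⊆ B n ∪ C n)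
    (hB : Tendsto (fun n => P (B n)) atTop (𝓝 0)) (hC : Tendsto (fun n => P (C n)) atTop (𝓝 0)) :
    Tendsto (fun n => P (A n)) atTop (𝓝 0) := by
  refine tendsto_of_tendsto_of_tendsto_of_le_of_le tendsto_const_nhds (by simpa using hB.add hC)
    (fun _ => zero_le) fun n => (measure_mono (h n)).trans (measure_union_le _ _)

theorem tendsto_measure_of_subset {A B : ℕ → Set Ω} (h : ∀ n, A n ⊆ B n)
    (hB : Tendsto (fun n => P (B n)) atTop (𝓝 0)) :
    Tendsto (fun n => P (A n)) atTop (𝓝 0) :=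
  tendsto_measure_of_subset_union (fun n => (h n).trans Set.subset_union_left) hB hB

/-- The continuous function that is `1` up to `t`, `0` from `t + h` on, and affine between. -/
noncomputable def ramp (t h : ℝ) (x : ℝ) : ℝ := max 0 (min 1 (1 - (x - t) / h))

theorem ramp_nonneg (t h x : ℝ) : 0 ≤ ramp t h x := le_max_left _ _

theorem ramp_le_one (t h x : ℝ) : ramp t h x ≤ 1 := max_le zero_le_one (min_le_left _ _)

theorem lipschitzWith_ramp (t h : ℝ) : ∃ K, LipschitzWith K (ramp t h) := by
  have h1 : LipschitzWith (Real.nnabs h⁻¹) fun x : ℝ => 1 - (x - t) / h := by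
    refine LipschitzWith.of_dist_le_mul fun x y => le_of_eq ?_
    rw [Real.dist_eq, Real.dist_eq, Real.coe_nnabs, ← abs_mul, ← abs_neg]
    congr 1
    rw [div_eq_mul_inv, div_eq_mul_inv]
    ring
  exact ⟨_, (h1.const_min 1).const_max 0⟩

/-- The ramp as a bounded continuous function. -/
noncomputable def rampBCF (t h : ℝ) : BoundedContinuousFunction ℝ ℝ :=
  BoundedContinuousFunction.ofNormedAddCommGroup (ramp t h)
    (lipschitzWith_ramp t h).choose_spec.continuous 1 fun x => by
      rw [Real.norm_of_nonneg (ramp_nonneg t h x)]; exact ramp_le_one t h x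

theorem indicator_Iic_le_ramp {t h : ℝ} (hh : 0 < h) (x : ℝ) :
    (Set.Iic t).indicator (fun _ => (1 : ℝ)) x ≤ ramp t h x := by
  by_cases hx : x ≤ t
  · rw [Set.indicator_of_mem (by exact hx)]
    refine le_max_of_le_right (le_min le_rfl ?_)
    have : (x - t) / h ≤ 0 := div_nonpos_of_nonpos_of_nonneg (by linarith) hh.le
    linarith
  · rw [Set.indicator_of_notMem (by exact hx)]
    exact ramp_nonneg _ _ _

theorem ramp_le_indicator_Iic {t h : ℝ} (hh : 0 < h) (x : ℝ) :
    ramp t h x ≤ (Set.Iic (t + h)).indicator (fun _ => (1 : ℝ)) x := by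
  by_cases hx : x ≤ t + h
  · rw [Set.indicator_of_mem (by exact hx)]
    exact ramp_le_one _ _ _
  · rw [Set.indicator_of_notMem (by exact hx)]
    refine max_le le_rfl (min_le_of_right_le ?_)
    have : 1 ≤ (x - t) / h := by rw [le_div_iff₀ hh]; linarith [not_le.1 hx]
    linarith

theorem integral_indicator_Iic {m : Measure ℝ} [IsProbabilityMeasure m] (t : ℝ) :
    ∫ x, (Set.Iic t).indicator (fun _ => (1 : ℝ)) x ∂m = cdf m t := by
  rw [integral_indicator_const _ measurableSet_Iic, cdf_eq_real]; simp

theorem cdf_le_integral_ramp {m : Measure ℝ} [IsProbabilityMeasure m] {t h : ℝ} (hh : 0 < h) :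
    cdf m t ≤ ∫ x, ramp t h x ∂m := by
  rw [← integral_indicator_Iic]
  exact integral_mono ((integrable_const _).indicator measurableSet_Iic)
    ((rampBCF t h).integrable m) (indicator_Iic_le_ramp hh)

theorem integral_ramp_le_cdf {m : Measure ℝ} [IsProbabilityMeasure m] {t h : ℝ} (hh : 0 < h) :
    ∫ x, ramp t h x ∂m ≤ cdf m (t + h) := by
  rw [← integral_indicator_Iic]
  exact integral_mono ((rampBCF t h).integrable m)
    ((integrable_const _).indicator measurableSet_Iic) (ramp_le_indicator_Iic hh)

/-- Random distribution functions converge in probability to a continuous one when the integrals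
of the ramp functions do. -/
theorem tendstoInMeasure_cdf {m : Measure ℝ} [IsProbabilityMeasure m] (hc : Continuous (cdf m))
    {H : ℕ → Ω → ℝ → ℝ} {A : ℝ → ℝ → ℕ → Ω → ℝ}
    (hlow : ∀ t h n ω, 0 < h → A t h n ω ≤ H n ω (t + h))
    (hup : ∀ t h n ω, 0 < h → H n ω t ≤ A t h n ω)
    (hA : ∀ t h, 0 < h →
      TendstoInMeasure P (A t h) atTop (fun _ => ∫ x, ramp t h x ∂m)) (t : ℝ) :
    TendstoInMeasure P (fun n ω => H n ω t) atTop (fun _ => cdf m t) := by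
  rw [tendstoInMeasure_iff_dist]
  intro ε hε
  obtain ⟨δ, hδ, hδ'⟩ := Metric.continuousAt_iff.1 (hc.continuousAt (x := t)) (ε / 2) (by positivity)
  set h := δ / 2 with hh
  have hpos : 0 < h := by positivity
  have hcl : ∀ x, |x - t| ≤ h → |cdf m x - cdf m t| < ε / 2 := fun x hx => by
    have := hδ' (x := x) (by rw [Real.dist_eq]; linarith)
    rwa [Real.dist_eq] at this
  have h1 := abs_lt.1 (hcl (t + h) (by rw [add_sub_cancel_left, abs_of_pos hpos]))
  have h2 := abs_lt.1 (hcl (t - h) (by rw [sub_sub_cancel_left, abs_neg, abs_of_pos hpos]))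
  have hA1 := tendstoInMeasure_iff_dist.1 (hA t h hpos) (ε / 2) (by positivity)
  have hA2 := tendstoInMeasure_iff_dist.1 (hA (t - h) h hpos) (ε / 2) (by positivity)
  refine tendsto_measure_of_subset_union (fun n ω hω => ?_) hA1 hA2
  simp only [Set.mem_union, Set.mem_ofPred_eq, Real.dist_eq] at hω ⊢
  by_contra! hcon
  have a1 := abs_lt.1 hcon.1
  have a2 := abs_lt.1 hcon.2
  have b1 := integral_ramp_le_cdf (m := m) (t := t) hpos
  have b2 := cdf_le_integral_ramp (m := m) (t := t - h) hpos
  have c1 := hup t h n ω hpos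
  have c2 := hlow (t - h) h n ω hpos
  rw [sub_add_cancel] at c2
  refine absurd hω (not_le.2 (abs_lt.2 ⟨?_, ?_⟩)) <;> linarith

/-- Quantiles converge in probability when the distribution functions do, to a strictly
increasing limit. -/
theorem tendstoInMeasure_quantile {F : ℝ → ℝ} (hF : StrictMono F) {H : ℕ → Ω → ℝ → ℝ}
    (hH : ∀ t, TendstoInMeasure P (fun n ω => H n ω t) atTop (fun _ => F t)) {a q : ℝ}
    (hq : F q = a) {Q : ℕ → Ω → ℝ} (hlow : ∀ n ω t, Q n ω < t → a ≤ H n ω t)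
    (hup : ∀ n ω t, t < Q n ω → H n ω t ≤ a) :
    TendstoInMeasure P Q atTop (fun _ => q) := by
  rw [tendstoInMeasure_iff_dist]
  intro ε hε
  have h1 : 0 < F (q + ε / 2) - a := by have := hF (show q < q + ε / 2 by linarith); linarith
  have h2 : 0 < a - F (q - ε / 2) := by have := hF (show q - ε / 2 < q by linarith); linarith
  refine tendsto_measure_of_subset_union (fun n ω hω => ?_)
    (tendstoInMeasure_iff_dist.1 (hH (q + ε / 2)) _ h1)
    (tendstoInMeasure_iff_dist.1 (hH (q - ε / 2)) _ h2)
  simp only [Set.mem_union, Set.mem_ofPred_eq, Real.dist_eq] at hω ⊢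
  rcases le_abs.1 hω with hω | hω
  · left
    have := hup n ω (q + ε / 2) (by linarith)
    exact le_abs.2 (Or.inr (by linarith))
  · right
    have := hlow n ω (q - ε / 2) (by linarith)
    exact le_abs.2 (Or.inl (by linarith))

theorem tendstoInMeasure_sub {X Y : ℕ → Ω → ℝ} {x y : ℝ}
    (hX : TendstoInMeasure P X atTop fun _ => x) (hY : TendstoInMeasure P Y atTop fun _ => y) :
    TendstoInMeasure P (fun n ω => X n ω - Y n ω) atTop fun _ => x - y := by
  rw [tendstoInMeasure_iff_dist] at *
  intro ε hε
  refine tendsto_measure_of_subset_union (fun n ω hω => ?_) (hX (ε / 2) (by positivity))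
    (hY (ε / 2) (by positivity))
  simp only [Set.mem_union, Set.mem_ofPred_eq, Real.dist_eq] at hω ⊢
  by_contra! hcon
  have a1 := abs_lt.1 hcon.1
  have a2 := abs_lt.1 hcon.2
  refine absurd hω (not_le.2 (abs_lt.2 ⟨?_, ?_⟩)) <;> linarith

/-- The mass that random laws give to random intervals converges in probability when their
distribution functions and the end points of the intervals do. -/
theorem tendstoInMeasure_measureReal_Icc {F : ℝ → ℝ} (hF : Continuous F)
    {G : ℕ → Ω → Measure ℝ} (hG : ∀ n ω, IsProbabilityMeasure (G n ω))
    (hGF : ∀ t, TendstoInMeasure P (fun n ω => (G n ω).real (Set.Iic t)) atTop (fun _ => F t))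
    {q₁ q₂ : ℝ} (hq : q₁ ≤ q₂) {Q₁ Q₂ : ℕ → Ω → ℝ}
    (hQ₁ : TendstoInMeasure P Q₁ atTop fun _ => q₁)
    (hQ₂ : TendstoInMeasure P Q₂ atTop fun _ => q₂) :
    TendstoInMeasure P (fun n ω => (G n ω).real (Set.Icc (Q₁ n ω) (Q₂ n ω))) atTop
      (fun _ => F q₂ - F q₁) := by
  rw [tendstoInMeasure_iff_dist]
  intro ε hε
  have hcont : ∀ q : ℝ, ∃ δ > 0, ∀ x, |x - q| ≤ δ → |F x - F q| < ε / 4 := fun q => by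
    obtain ⟨δ, hδ, hδ'⟩ := Metric.continuousAt_iff.1 (hF.continuousAt (x := q)) (ε / 4)
      (by positivity)
    refine ⟨δ / 2, by positivity, fun x hx => ?_⟩
    have := hδ' (x := x) (by rw [Real.dist_eq]; linarith)
    rwa [Real.dist_eq] at this
  obtain ⟨δ₁, hδ₁, hF₁⟩ := hcont q₁
  obtain ⟨δ₂, hδ₂, hF₂⟩ := hcont q₂
  have hε4 : 0 < ε / 4 := by positivity
  have hb : ∀ t, Tendsto (fun n => P {ω | ε / 4 ≤ dist ((G n ω).real (Set.Iic t)) (F t)}) atTop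
      (𝓝 0) := fun t => tendstoInMeasure_iff_dist.1 (hGF t) _ hε4
  have e1 := tendsto_measure_of_subset_union (fun n => subset_rfl) (hb (q₁ - δ₁)) (hb (q₁ + δ₁))
  have e2 := tendsto_measure_of_subset_union (fun n => subset_rfl) (hb (q₂ - δ₂)) (hb (q₂ + δ₂))
  have e3 := tendsto_measure_of_subset_union (fun n => subset_rfl)
    (tendstoInMeasure_iff_dist.1 hQ₁ δ₁ hδ₁) (tendstoInMeasure_iff_dist.1 hQ₂ δ₂ hδ₂)
  refine tendsto_measure_of_subset_union (fun n ω hω => ?_)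
    (tendsto_measure_of_subset_union (fun n => subset_rfl) e1 e2) e3
  by_contra hcon
  simp only [Set.mem_union, Set.mem_ofPred_eq, Real.dist_eq, not_or, not_le] at hω hcon
  obtain ⟨⟨⟨a1, a2⟩, a3, a4⟩, b1, b2⟩ := hcon
  rw [abs_lt] at a1 a2 a3 a4 b1 b2
  have c1 := abs_lt.1 (hF₁ (q₁ - δ₁) (by rw [sub_sub_cancel_left, abs_neg, abs_of_pos hδ₁]))
  have c2 := abs_lt.1 (hF₁ (q₁ + δ₁) (by rw [add_sub_cancel_left, abs_of_pos hδ₁]))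
  have c3 := abs_lt.1 (hF₂ (q₂ - δ₂) (by rw [sub_sub_cancel_left, abs_neg, abs_of_pos hδ₂]))
  have c4 := abs_lt.1 (hF₂ (q₂ + δ₂) (by rw [add_sub_cancel_left, abs_of_pos hδ₂]))
  have hp := hG n ω
  have hIoc : ∀ s t, s ≤ t → (G n ω).real (Set.Ioc s t) =
      (G n ω).real (Set.Iic t) - (G n ω).real (Set.Iic s) := fun s t hst => by
    rw [← measureReal_sdiff (Set.Iic_subset_Iic.2 hst) measurableSet_Iic]
    congr 1
    ext x; simp [and_comm]
  have up : (G n ω).real (Set.Icc (Q₁ n ω) (Q₂ n ω)) ≤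
      (G n ω).real (Set.Iic (q₂ + δ₂)) - (G n ω).real (Set.Iic (q₁ - δ₁)) := by
    rw [← hIoc _ _ (by linarith)]
    exact measureReal_mono fun x hx => ⟨by linarith [hx.1], by linarith [hx.2]⟩
  have low : (G n ω).real (Set.Iic (q₂ - δ₂)) - (G n ω).real (Set.Iic (q₁ + δ₁)) ≤
      (G n ω).real (Set.Icc (Q₁ n ω) (Q₂ n ω)) := by
    rcases le_total (q₁ + δ₁) (q₂ - δ₂) with hle | hle
    · rw [← hIoc _ _ hle]
      exact measureReal_mono fun x hx => ⟨by linarith [hx.1], by linarith [hx.2]⟩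
    · have := measureReal_mono (μ := G n ω) (Set.Iic_subset_Iic.2 hle)
      have := measureReal_nonneg (μ := G n ω) (s := Set.Icc (Q₁ n ω) (Q₂ n ω))
      linarith
  refine absurd hω (not_le.2 (abs_lt.2 ⟨?_, ?_⟩)) <;> linarith

variable [IsProbabilityMeasure P]

/-- Bounded convergence: convergence in probability implies convergence in mean. -/
theorem tendsto_lintegral_abs_sub {X : ℕ → Ω → ℝ} {c C : ℝ}
    (hX : TendstoInMeasure P X atTop fun _ => c) (hC : ∀ n ω, |X n ω - c| ≤ C) :
    Tendsto (fun n => ∫⁻ ω, ENNReal.ofReal |X n ω - c| ∂P) atTop (𝓝 0) := by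
  rw [ENNReal.tendsto_nhds_zero]
  intro ε hε
  by_cases htop : ε = ⊤
  · simp [htop]
  set e := ε.toReal / 2 with he
  have hε0 : 0 < ε.toReal := ENNReal.toReal_pos hε.ne' htop
  have he0 : 0 < e := by positivity
  have h1 := tendstoInMeasure_iff_dist.1 hX e he0
  have h2 : Tendsto (fun n => ENNReal.ofReal C * P {ω | e ≤ dist (X n ω) c}) atTop (𝓝 0) := by
    simpa using ENNReal.Tendsto.const_mul h1 (Or.inr ENNReal.ofReal_ne_top)
  filter_upwards [h2.eventually (ge_mem_nhds (ENNReal.ofReal_pos.2 he0))] with n hn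
  calc ∫⁻ ω, ENNReal.ofReal |X n ω - c| ∂P
      ≤ ∫⁻ ω, (ENNReal.ofReal e +
          {ω | e ≤ dist (X n ω) c}.indicator (fun _ => ENNReal.ofReal C) ω) ∂P := by
        refine lintegral_mono fun ω => ?_
        by_cases hω : e ≤ dist (X n ω) c
        · rw [Set.indicator_of_mem (by exact hω)]
          exact (ENNReal.ofReal_le_ofReal (hC n ω)).trans le_add_self
        · rw [Set.indicator_of_notMem (by exact hω), add_zero]
          rw [Real.dist_eq, not_le] at hω
          exact ENNReal.ofReal_le_ofReal hω.le
    _ ≤ ENNReal.ofReal e + ENNReal.ofReal C * P {ω | e ≤ dist (X n ω) c} := by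
        rw [lintegral_add_left measurable_const, lintegral_const, measure_univ, mul_one]
        gcongr
        exact lintegral_indicator_const_le _ _
    _ ≤ ENNReal.ofReal e + ENNReal.ofReal e := by gcongr
    _ = ε := by
        rw [← ENNReal.ofReal_add he0.le he0.le, he, add_halves, ENNReal.ofReal_toReal htop]

theorem tendsto_integral_abs_sub {X : ℕ → Ω → ℝ} {c C : ℝ} (hXm : ∀ n, Measurable (X n))
    (hX : TendstoInMeasure P X atTop fun _ => c) (hC : ∀ n ω, |X n ω - c| ≤ C) :
    Tendsto (fun n => ∫ ω, |X n ω - c| ∂P) atTop (𝓝 0) := by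
  have h := tendsto_lintegral_abs_sub hX hC
  have e : ∀ n, ∫ ω, |X n ω - c| ∂P = (∫⁻ ω, ENNReal.ofReal |X n ω - c| ∂P).toReal := fun n =>
    integral_eq_lintegral_of_nonneg_ae (Eventually.of_forall fun _ => abs_nonneg _)
      (((hXm n).sub_const c).abs.aestronglyMeasurable)
  simp only [e]
  exact (ENNReal.tendsto_toReal ENNReal.zero_ne_top).comp h

/-- Convergence in mean square implies convergence in probability. -/
theorem tendstoInMeasure_of_integral_sq {X : ℕ → Ω → ℝ} {c C : ℝ} (hXm : ∀ n, Measurable (X n))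
    (hC : ∀ n ω, |X n ω - c| ≤ C)
    (h : Tendsto (fun n => ∫ ω, (X n ω - c) ^ 2 ∂P) atTop (𝓝 0)) :
    TendstoInMeasure P X atTop fun _ => c := by
  rw [tendstoInMeasure_iff_measureReal_dist]
  intro ε hε
  refine squeeze_zero (fun _ => measureReal_nonneg) (fun n => ?_)
    (by simpa using h.div_const (ε ^ 2))
  have hi : Integrable (fun ω => (X n ω - c) ^ 2) P :=
    integrable_of_abs_le (C := C ^ 2) (((hXm n).sub_const c).pow_const 2) fun ω => by
      rw [abs_pow]
      exact pow_le_pow_left₀ (abs_nonneg _) (hC n ω) 2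
  have := mul_meas_ge_le_integral_of_nonneg (μ := P)
    (Eventually.of_forall fun ω => sq_nonneg (X n ω - c)) hi (ε ^ 2)
  rw [le_div_iff₀ (by positivity), mul_comm]
  refine le_trans (mul_le_mul_of_nonneg_left (measureReal_mono fun ω hω => ?_) (sq_nonneg ε)) this
  simp only [Set.mem_ofPred_eq, Real.dist_eq] at hω ⊢
  rw [← sq_abs (X n ω - c)]
  exact pow_le_pow_left₀ hε.le hω 2

end InProbability

/-! ### Reduction to the standardized model -/

section Standardize

theorem Param.rootMul_sub {k : ℕ} (θ : Param k) (a b : EuclideanSpace ℝ (Fin k)) :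
    θ.rootMul (a - b) = θ.rootMul a - θ.rootMul b := by
  ext j
  simp [Param.rootMul, Matrix.mulVec_sub]

theorem Param.measurable_rootMul {k : ℕ} (θ : Param k) : Measurable θ.rootMul := by
  unfold Param.rootMul
  refine (WithLp.measurable_toLp 2 _).comp ?_
  have : Continuous fun b : EuclideanSpace ℝ (Fin k) => (CFC.sqrt θ.S).mulVec b.ofLp := by fun_prop
  exact this.measurable

theorem Param.inner_rootMul_left {k : ℕ} (θ : Param k) (a b : EuclideanSpace ℝ (Fin k)) :
    ⟪θ.rootMul a, b⟫ = ⟪a, θ.rootMul b⟫ := by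
  have hs : (CFC.sqrt θ.S).transpose = CFC.sqrt θ.S := by
    have h1 : star (CFC.sqrt θ.S) = CFC.sqrt θ.S := (CFC.sqrt_nonneg θ.S).isSelfAdjoint
    rwa [Matrix.star_eq_conjTranspose, Matrix.conjTranspose_eq_transpose_of_trivial] at h1
  simp only [EuclideanSpace.inner_eq_star_dotProduct, Param.rootMul, star_trivial]
  rw [Matrix.dotProduct_mulVec, ← Matrix.mulVec_transpose, hs]

/-- The observation with parameter `θ` that belongs to a standardized observation. -/
noncomputable def Param.toObs {k : ℕ} (θ : Param k) (z : EuclideanSpace ℝ (Fin k) × ℝ) : Obs k :=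
  (⟪θ.β, θ.rootMul z.1⟫ + θ.σ * z.2, θ.rootMul z.1)

/-- The standardized error `Σ^{1/2} (b - β) / σ` of an estimate `b`. -/
noncomputable def Param.stdErr {k : ℕ} (θ : Param k) (b : EuclideanSpace ℝ (Fin k)) :
    EuclideanSpace ℝ (Fin k) :=
  θ.σ⁻¹ • θ.rootMul (b - θ.β)

theorem Param.measurable_toObs {k : ℕ} (θ : Param k) : Measurable θ.toObs := by
  have h := θ.measurable_rootMul.comp
    (measurable_fst : Measurable fun z : EuclideanSpace ℝ (Fin k) × ℝ => z.1)
  have h1 : Measurable fun z : EuclideanSpace ℝ (Fin k) × ℝ => ⟪θ.β, θ.rootMul z.1⟫ :=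
    (by fun_prop : Measurable fun x : EuclideanSpace ℝ (Fin k) => ⟪θ.β, x⟫).comp h
  exact (h1.add (measurable_snd.const_mul _)).prodMk h

theorem Param.measurable_stdErr {k : ℕ} (θ : Param k) : Measurable θ.stdErr := by
  have h : Measurable fun b => θ.rootMul (b - θ.β) :=
    θ.measurable_rootMul.comp (measurable_id.sub_const _)
  exact h.const_smul θ.σ⁻¹

theorem Param.toObs_sub_inner {k : ℕ} (θ : Param k) (z : EuclideanSpace ℝ (Fin k) × ℝ)
    (b : EuclideanSpace ℝ (Fin k)) :
    (θ.toObs z).1 - ⟪(θ.toObs z).2, b⟫ = θ.σ * predError z (θ.stdErr b) := by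
  have hσ := θ.σ_pos.ne'
  simp only [Param.toObs, predError, Param.stdErr, real_inner_smul_right]
  rw [← θ.inner_rootMul_left z.1, inner_sub_right, real_inner_comm θ.β]
  field_simp
  ring

variable {Ω : Type*} [MeasurableSpace Ω] (v : ℕ → ℕ → Ω → ℝ) (l u : ℕ → Ω → ℝ)

theorem training_eq {k : ℕ} (θ : Param k) (m : ℕ) (ω : Ω) :
    training v l u θ m ω = θ.toObs ∘ rawSample v l u k m ω := rfl

/-- The standardized error of the estimate, as a function of the standardized sample. -/
noncomputable def stdRule (bhat : Estimator) {k : ℕ} (θ : Param k) (m : ℕ)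
    (w : Fin m → EuclideanSpace ℝ (Fin k) × ℝ) : EuclideanSpace ℝ (Fin k) :=
  θ.stdErr (bhat m k (θ.toObs ∘ w))

theorem measurable_stdRule {bhat : Estimator} (hbhat : ∀ m k, Measurable (bhat m k)) {k : ℕ}
    (θ : Param k) (m : ℕ) : Measurable (stdRule bhat θ m) :=
  θ.measurable_stdErr.comp ((hbhat m k).comp (measurable_pi_lambda _ fun i =>
    θ.measurable_toObs.comp (measurable_pi_apply i)))

theorem scaledInfluence_eq (bhat : Estimator) {k : ℕ} (θ : Param k) (n : ℕ) (ω : Ω) :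
    scaledInfluence v l u bhat θ n ω = stdRule bhat θ (n + 1) (rawSample v l u k (n + 1) ω) -
      stdRule bhat θ n ((0 : Fin (n + 1)).removeNth (rawSample v l u k (n + 1) ω)) := by
  simp only [scaledInfluence, stdRule, Param.stdErr]
  rw [← smul_sub, ← θ.rootMul_sub, sub_sub_sub_cancel_right]
  rfl

theorem looResidual_eq (bhat : Estimator) {n k : ℕ} (θ : Param k)
    (w : Fin (n + 1) → EuclideanSpace ℝ (Fin k) × ℝ) (i : Fin (n + 1)) :
    looResidual bhat (θ.toObs ∘ w) i =
      θ.σ * predError (w i) (stdRule bhat θ n (i.removeNth w)) :=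
  θ.toObs_sub_inner (w i) _

end Standardize

/-! ### Consistency of the empirical and of the conditional error distribution -/

section Consistency

variable {Ω : Type*} [MeasurableSpace Ω] {P : Measure Ω} [IsProbabilityMeasure P]
  {v : ℕ → ℕ → Ω → ℝ} {l u : ℕ → Ω → ℝ} {k : ℕ → ℕ}
  {D : (n : ℕ) → (Fin (n + 1) → EuclideanSpace ℝ (Fin (k n)) × ℝ) → EuclideanSpace ℝ (Fin (k n))}
  {D' : (n : ℕ) → (Fin n → EuclideanSpace ℝ (Fin (k n)) × ℝ) → EuclideanSpace ℝ (Fin (k n))}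
  {τ : ℝ}

/-- The conditional law of the standardized prediction error, given a standardized error `b` of
the estimate. -/
noncomputable def errorLaw (P : Measure Ω) (v : ℕ → ℕ → Ω → ℝ) (l u : ℕ → Ω → ℝ) {k : ℕ}
    (b : EuclideanSpace ℝ (Fin k)) : Measure ℝ :=
  (P.map (rawObs v l u k 0)).map fun z => predError z b

theorem measurable_predError_left {k : ℕ} (b : EuclideanSpace ℝ (Fin k)) :
    Measurable fun z : EuclideanSpace ℝ (Fin k) × ℝ => predError z b :=
  measurable_predError.comp (by fun_prop : Measurable fun z => (z, b))

theorem IsDataModel.isProbabilityMeasure_errorLaw (h : IsDataModel P v l u) {k : ℕ}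
    (b : EuclideanSpace ℝ (Fin k)) : IsProbabilityMeasure (errorLaw P v l u b) := by
  have := h.isProbabilityMeasure_map_rawObs k 0
  exact Measure.isProbabilityMeasure_map (measurable_predError_left b).aemeasurable

theorem IsDataModel.integral_errorLaw (h : IsDataModel P v l u) {k : ℕ}
    (b : EuclideanSpace ℝ (Fin k)) (φ : BoundedContinuousFunction ℝ ℝ) :
    ∫ x, φ x ∂(errorLaw P v l u b) = ∫ ω, φ (predError (rawObs v l u k 0 ω) b) ∂P := by
  have hm : Measurable fun z => φ (predError z b) :=
    φ.continuous.measurable.comp (measurable_predError_left b)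
  rw [errorLaw, integral_map (measurable_predError_left b).aemeasurable
    φ.continuous.measurable.aestronglyMeasurable,
    integral_map (h.measurable_rawObs k 0).aemeasurable hm.aestronglyMeasurable]

/-- Integrals against the conditional law of the prediction error converge in probability. -/
theorem IsDataModel.tendstoInMeasure_integral_errorLaw (h : IsDataModel P v l u)
    (hnorm : ∀ ε : ℝ, 0 < ε → Tendsto (fun n => P {ω |
      ε < |‖D n (rawSample v l u (k n) (n + 1) ω)‖ - τ|}) atTop (𝓝 0))
    (hmax : P.map (v 0 0) = gaussianReal 0 1 ∨ ∀ ε : ℝ, 0 < ε → Tendsto (fun n => P {ω |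
      ∃ j, ε < |D n (rawSample v l u (k n) (n + 1) ω) j|}) atTop (𝓝 0))
    (φ : BoundedContinuousFunction ℝ ℝ) :
    TendstoInMeasure P (fun n ω => ∫ x, φ x ∂(errorLaw P v l u
      (D n (rawSample v l u (k n) (n + 1) ω)))) atTop
      (fun _ => ∫ x, φ x ∂(limitLaw P l u τ)) := by
  rw [tendstoInMeasure_iff_dist]
  intro ε hε
  obtain ⟨η, hη, hη'⟩ := h.exists_abs_integral_predError_sub_le τ φ (ε := ε / 2) (by positivity)
  simp only [h.integral_errorLaw, Real.dist_eq]
  rcases hmax with hG | hmax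
  · refine tendsto_measure_of_subset (fun n ω hω => ?_) (hnorm η hη)
    simp only [Set.mem_ofPred_eq] at hω ⊢
    by_contra hcon
    have := hη' _ _ (not_lt.1 hcon) (Or.inl hG)
    linarith
  · refine tendsto_measure_of_subset_union (fun n ω hω => ?_) (hnorm η hη) (hmax η hη)
    simp only [Set.mem_union, Set.mem_ofPred_eq] at hω ⊢
    by_contra! hcon
    have := hη' _ _ hcon.1 (Or.inr hcon.2)
    linarith

/-- The average of a bounded Lipschitz function over the leave-one-out errors converges in
probability to its integral under the limit law. -/
theorem IsDataModel.tendstoInMeasure_average (h : IsDataModel P v l u)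
    (hDm : ∀ n, Measurable (D n)) (hD'm : ∀ n, Measurable (D' n))
    (hD : ∀ n (w : Fin (n + 1) → EuclideanSpace ℝ (Fin (k n)) × ℝ)
      (π : Equiv.Perm (Fin (n + 1))), D n (w ∘ π) = D n w)
    (hnorm : ∀ ε : ℝ, 0 < ε → Tendsto (fun n => P {ω |
      ε < |‖D n (rawSample v l u (k n) (n + 1) ω)‖ - τ|}) atTop (𝓝 0))
    (hmax : P.map (v 0 0) = gaussianReal 0 1 ∨ ∀ ε : ℝ, 0 < ε → Tendsto (fun n => P {ω |
      ∃ j, ε < |D n (rawSample v l u (k n) (n + 1) ω) j|}) atTop (𝓝 0))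
    (hinf : ∀ ε : ℝ, 0 < ε → Tendsto (fun n => P {ω |
      ε < ‖D n (rawSample v l u (k n) (n + 1) ω) -
        D' n ((0 : Fin (n + 1)).removeNth (rawSample v l u (k n) (n + 1) ω))‖}) atTop (𝓝 0))
    (φ : BoundedContinuousFunction ℝ ℝ) {K : NNReal} (hφ : LipschitzWith K φ) :
    TendstoInMeasure P (fun n ω => (∑ i : Fin (n + 1), φ (predError
        (rawSample v l u (k n) (n + 1) ω i)
        (D' n (i.removeNth (rawSample v l u (k n) (n + 1) ω))))) / (n + 1 : ℝ)) atTop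
      (fun _ => ∫ x, φ x ∂(limitLaw P l u τ)) := by
  have hpl := h.isProbabilityMeasure_limitLaw τ
  have hpr : ∀ k, IsProbabilityMeasure (P.map (rawObs v l u k 0)) := fun k =>
    h.isProbabilityMeasure_map_rawObs k 0
  set c := ∫ x, φ x ∂(limitLaw P l u τ) with hc
  set M := ‖φ‖ with hM
  have hφM : ∀ x, |φ x| ≤ M := fun x => φ.norm_coe_le_norm x
  have hM0 : 0 ≤ M := norm_nonneg _
  have hcM : |c| ≤ M := by
    have : ‖c‖ ≤ M * (limitLaw P l u τ).real Set.univ :=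
      norm_integral_le_of_norm_le_const (Eventually.of_forall hφM)
    simpa using this
  have hm : ∀ n, MeasurePreserving (rawSample v l u (k n) (n + 1)) P _ := fun n =>
    h.measurePreserving_rawSample (k n) (n + 1)
  -- the centred test function, as a function of an observation and of an estimate
  let f : (n : ℕ) → EuclideanSpace ℝ (Fin (k n)) × ℝ → EuclideanSpace ℝ (Fin (k n)) → ℝ :=
    fun n z b => φ (predError z b) - c
  have hf : ∀ n, Measurable (Function.uncurry (f n)) := fun n =>
    (φ.continuous.measurable.comp measurable_predError).sub_const c
  have hfM : ∀ n z b, |f n z b| ≤ 2 * M := fun n z b => abs_sub_le_two_mul (hφM _) hcM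
  have hAm : ∀ n, Measurable fun w : Fin (n + 1) → EuclideanSpace ℝ (Fin (k n)) × ℝ =>
      (∑ i : Fin (n + 1), φ (predError (w i) (D' n (i.removeNth w)))) / (n + 1 : ℝ) := fun n => by
    refine Measurable.div_const (Finset.measurable_fun_sum _ fun i _ => ?_) _
    exact (φ.continuous.measurable.comp measurable_predError).comp
      ((measurable_pi_apply i).prodMk ((hD'm n).comp (measurable_removeNth i)))
  have hN : ∀ n : ℕ, (0 : ℝ) < n + 1 := fun n => by positivity
  have hctr : ∀ n (w : Fin (n + 1) → EuclideanSpace ℝ (Fin (k n)) × ℝ),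
      (∑ i : Fin (n + 1), φ (predError (w i) (D' n (i.removeNth w)))) / (n + 1 : ℝ) - c =
      (∑ i : Fin (n + 1), f n (w i) (D' n (i.removeNth w))) / (n + 1 : ℝ) := fun n w => by
    have := (hN n).ne'
    simp only [f, Finset.sum_sub_distrib, Finset.sum_const, Finset.card_univ, Fintype.card_fin,
      nsmul_eq_mul]
    push_cast
    field_simp
  have habs : ∀ n (w : Fin (n + 1) → EuclideanSpace ℝ (Fin (k n)) × ℝ),
      |(∑ i : Fin (n + 1), φ (predError (w i) (D' n (i.removeNth w)))) / (n + 1 : ℝ) - c| ≤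
      2 * M := fun n w => by
    rw [hctr, abs_div, abs_of_pos (hN n), div_le_iff₀ (hN n)]
    calc _ ≤ ∑ i : Fin (n + 1), |f n (w i) (D' n (i.removeNth w))| :=
          Finset.abs_sum_le_sum_abs _ _
      _ ≤ ∑ _i : Fin (n + 1), 2 * M := Finset.sum_le_sum fun i _ => hfM _ _ _
      _ = _ := by simp; ring
  refine tendstoInMeasure_of_integral_sq (fun n => (hAm n).comp (hm n).measurable)
    (fun n ω => habs n _) ?_
  -- the mean of a term given the full-sample estimate
  have hcond : Tendsto (fun n => ∫ w, |∫ z, f n z (D n w) ∂(P.map (rawObs v l u (k n) 0))|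
      ∂(Measure.pi fun _ => P.map (rawObs v l u (k n) 0))) atTop (𝓝 0) := by
    have hg : ∀ n b, ∫ z, f n z b ∂(P.map (rawObs v l u (k n) 0)) =
        ∫ x, φ x ∂(errorLaw P v l u b) - c := fun n b => by
      have hi : Integrable (fun z => φ (predError z b)) (P.map (rawObs v l u (k n) 0)) :=
        integrable_of_abs_le (φ.continuous.measurable.comp (measurable_predError_left b))
          fun z => hφM _
      simp only [f]
      rw [integral_sub hi (integrable_const c), integral_const, probReal_univ, one_smul, errorLaw,
        integral_map (measurable_predError_left b).aemeasurable
          φ.continuous.measurable.aestronglyMeasurable]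
    have hgm : ∀ n, Measurable fun b : EuclideanSpace ℝ (Fin (k n)) =>
        ∫ x, φ x ∂(errorLaw P v l u b) := fun n => by
      have : Measurable fun q : EuclideanSpace ℝ (Fin (k n)) ×
          (EuclideanSpace ℝ (Fin (k n)) × ℝ) => f n q.2 q.1 := (hf n).comp measurable_swap
      have h2 := this.stronglyMeasurable.integral_prod_right'
        (ν := P.map (rawObs v l u (k n) 0)) |>.measurable
      simp only [hg] at h2
      simpa using h2.add_const c
    have hlim := tendsto_integral_abs_sub (C := 2 * M)
      (fun n => (hgm n).comp ((hDm n).comp (hm n).measurable))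
      (h.tendstoInMeasure_integral_errorLaw hnorm hmax φ) fun n ω => by
        rw [Function.comp_apply, ← hg]
        have := h.isProbabilityMeasure_map_rawObs (k n) 0
        have h3 : ‖∫ z, f n z (D n (rawSample v l u (k n) (n + 1) ω))
            ∂(P.map (rawObs v l u (k n) 0))‖ ≤ 2 * M * (P.map (rawObs v l u (k n) 0)).real Set.univ :=
          norm_integral_le_of_norm_le_const (Eventually.of_forall fun z => hfM _ _ _)
        simpa using h3
    refine hlim.congr fun n => ?_
    have hms : Measurable fun w => |∫ z, f n z (D n w) ∂(P.map (rawObs v l u (k n) 0))| := by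
      simp only [hg]
      exact (((hgm n).comp (hDm n)).sub_const c).abs
    rw [← MeasurePreserving.integral_comp_of_measurable (hm n) hms]
    simp only [hg]
    rfl
  have hstab : Tendsto (fun n => ∫ w, meanDist (P.map (rawObs v l u (k n) 0)) (f n) (D n w)
      (D' n ((0 : Fin (n + 1)).removeNth w)) ∂(Measure.pi fun _ => P.map (rawObs v l u (k n) 0)))
      atTop (𝓝 0) := by
    have hmd : ∀ n, Measurable fun w => meanDist (P.map (rawObs v l u (k n) 0)) (f n) (D n w)
        (D' n ((0 : Fin (n + 1)).removeNth w)) := fun n =>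
      measurable_meanDist (hf n) (hDm n) ((hD'm n).comp (measurable_removeNth 0))
    have hle : ∀ n b b', meanDist (P.map (rawObs v l u (k n) 0)) (f n) b b' ≤ K * ‖b - b'‖ :=
      fun n b b' => by
        have := h.meanDist_predError_le hφ hφM b b'
        refine le_trans (le_of_eq ?_) this
        simp only [meanDist, f, sub_sub_sub_cancel_right]
    have hprob : TendstoInMeasure P (fun n ω => meanDist (P.map (rawObs v l u (k n) 0)) (f n)
        (D n (rawSample v l u (k n) (n + 1) ω))
        (D' n ((0 : Fin (n + 1)).removeNth (rawSample v l u (k n) (n + 1) ω)))) atTop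
        fun _ => 0 := by
      rw [tendstoInMeasure_iff_dist]
      intro ε hε
      refine tendsto_measure_of_subset (fun n ω hω => ?_) (hinf (ε / (K + 1)) (by positivity))
      simp only [Set.mem_ofPred_eq, Real.dist_eq, sub_zero,
        abs_of_nonneg (meanDist_nonneg _ _)] at hω ⊢
      have h3 := hω.trans (hle n _ _)
      rw [div_lt_iff₀ (by positivity)]
      by_contra! hcon
      have hn := norm_nonneg (D n (rawSample v l u (k n) (n + 1) ω) -
        D' n ((0 : Fin (n + 1)).removeNth (rawSample v l u (k n) (n + 1) ω)))
      have : ‖D n (rawSample v l u (k n) (n + 1) ω) -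
        D' n ((0 : Fin (n + 1)).removeNth (rawSample v l u (k n) (n + 1) ω))‖ = 0 := by linarith
      rw [this] at h3
      linarith
    have hlim := tendsto_integral_abs_sub (C := 2 * (2 * M))
      (fun n => (hmd n).comp (hm n).measurable) hprob fun n ω => by
        rw [sub_zero]; exact abs_meanDist_le (hfM n) _ _
    refine hlim.congr fun n => ?_
    rw [← MeasurePreserving.integral_comp_of_measurable (hm n) (hmd n)]
    simp only [sub_zero, Function.comp_apply, abs_of_nonneg (meanDist_nonneg _ _)]
  have hbound : ∀ n, ∫ ω, ((∑ i : Fin (n + 1), φ (predError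
        (rawSample v l u (k n) (n + 1) ω i)
        (D' n (i.removeNth (rawSample v l u (k n) (n + 1) ω))))) / (n + 1 : ℝ) - c) ^ 2 ∂P ≤
      (2 * M) ^ 2 / (n + 1 : ℝ) + (2 * M * ∫ w, |∫ z, f n z (D n w) ∂(P.map (rawObs v l u (k n) 0))|
        ∂(Measure.pi fun _ => P.map (rawObs v l u (k n) 0)) +
      5 * (2 * M) * ∫ w, meanDist (P.map (rawObs v l u (k n) 0)) (f n) (D n w)
        (D' n ((0 : Fin (n + 1)).removeNth w))
        ∂(Measure.pi fun _ => P.map (rawObs v l u (k n) 0))) :=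
    fun n => by
      have h1 := integral_sq_average_le (hfM n) (hf n) (hDm n) (hD n) (hD'm n)
        (ν := P.map (rawObs v l u (k n) 0))
      simp only [← hctr] at h1
      rw [← MeasurePreserving.integral_comp_of_measurable (hm n)
        (((hAm n).sub_const c).pow_const 2)] at h1
      exact h1
  refine squeeze_zero (fun n => integral_nonneg fun _ => sq_nonneg _) hbound ?_
  have hz : Tendsto (fun n : ℕ => (2 * M) ^ 2 / ((n : ℝ) + 1)) atTop (𝓝 0) := by
    have := (tendsto_one_div_add_atTop_nhds_zero_nat (𝕜 := ℝ)).const_mul ((2 * M) ^ 2)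
    simpa [div_eq_mul_inv] using this
  have hsum := hz.add ((hcond.const_mul (2 * M)).add (hstab.const_mul (5 * (2 * M))))
  simp only [mul_zero, add_zero] at hsum
  exact hsum

end Consistency

/-! ### Conditional coverage -/

section Coverage

/-- For independent `X` and `Y`, conditioning on `X` amounts to freezing it. -/
theorem condProb_ae_eq_of_indepFun {Ω A B : Type*} [MeasurableSpace Ω] [MeasurableSpace A]
    [MeasurableSpace B] [StandardBorelSpace B] [Nonempty B] {P : Measure Ω}
    [IsProbabilityMeasure P] {X : Ω → A} {Y : Ω → B} (hX : Measurable X) (hY : Measurable Y)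
    (hXY : IndepFun X Y P) {s : Set (A × B)} (hs : MeasurableSet s) :
    P⟦{ω | (X ω, Y ω) ∈ s} | MeasurableSpace.comap X inferInstance⟧ =ᵐ[P]
      fun ω => (P.map Y).real {y | (X ω, y) ∈ s} := by
  have hpY : IsProbabilityMeasure (P.map Y) := Measure.isProbabilityMeasure_map hY.aemeasurable
  have h1 := condExp_prod_ae_eq_integral_condDistrib (μ := P)
    (f := s.indicator fun _ => (1 : ℝ)) hX hY.aemeasurable
    (stronglyMeasurable_const.indicator hs)
    (integrable_of_abs_le (C := 1) ((measurable_const.indicator hs).comp (hX.prodMk hY))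
      fun ω => by by_cases h : (X ω, Y ω) ∈ s <;> simp [h])
  have h2 : condDistrib Y X P =ᵐ[P.map X] Kernel.const A (P.map Y) := by
    refine condDistrib_ae_eq_of_measure_eq_compProd X hY.aemeasurable ?_
    rw [Measure.compProd_const, hXY.map_prod_eq_prod_map_map hX.aemeasurable hY.aemeasurable]
  have h3 := ae_of_ae_map hX.aemeasurable h2
  refine h1.trans ?_
  filter_upwards [h3] with ω hω
  rw [hω, Kernel.const_apply]
  have hm : MeasurableSet {y | (X ω, y) ∈ s} := measurable_prodMk_left hs
  have e : (fun y => s.indicator (fun _ => (1 : ℝ)) (X ω, y)) =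
      {y | (X ω, y) ∈ s}.indicator fun _ => (1 : ℝ) := by
    funext y; rfl
  rw [e, integral_indicator_const _ hm]
  simp

variable {Ω : Type*} [MeasurableSpace Ω] {P : Measure Ω} [IsProbabilityMeasure P]
  {v : ℕ → ℕ → Ω → ℝ} {l u : ℕ → Ω → ℝ} {bhat : Estimator} {qhat : QuantileRule}

theorem measurable_looResidual (hbhat : ∀ m k : ℕ, Measurable (bhat m k)) {n k : ℕ} :
    Measurable fun w : Fin (n + 1) → Obs k => looResidual bhat w := by
  refine measurable_pi_lambda _ fun i => ?_
  have h1 : Measurable fun w : Fin (n + 1) → Obs k => (w i).1 :=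
    measurable_fst.comp (measurable_pi_apply i)
  have h2 : Measurable fun w : Fin (n + 1) → Obs k => (w i).2 :=
    measurable_snd.comp (measurable_pi_apply i)
  have h3 : Measurable fun w : Fin (n + 1) → Obs k => bhat n k (i.removeNth w) :=
    (hbhat n k).comp (measurable_removeNth i)
  exact h1.sub (h2.inner h3)

theorem measurableSet_looInterval (hbhat : ∀ m k : ℕ, Measurable (bhat m k))
    (hqhat : qhat.IsValid) {α : ℝ} (hα0 : 0 < α) (hα1 : α < 1) {n k : ℕ} (θ : Param k) :
    MeasurableSet {q : (Fin (n + 1) → Obs k) × (EuclideanSpace ℝ (Fin k) × ℝ) |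
      (θ.toObs q.2).1 ∈ looInterval bhat qhat α q.1 (θ.toObs q.2).2} := by
  have ho : Measurable fun q : (Fin (n + 1) → Obs k) × (EuclideanSpace ℝ (Fin k) × ℝ) =>
      θ.toObs q.2 := θ.measurable_toObs.comp measurable_snd
  have hb : Measurable fun q : (Fin (n + 1) → Obs k) × (EuclideanSpace ℝ (Fin k) × ℝ) =>
      ⟪(θ.toObs q.2).2, bhat (n + 1) k q.1⟫ :=
    (measurable_snd.comp ho).inner ((hbhat (n + 1) k).comp measurable_fst)
  have hq : ∀ a : ℝ, 0 < a → a < 1 →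
      Measurable fun q : (Fin (n + 1) → Obs k) × (EuclideanSpace ℝ (Fin k) × ℝ) =>
        qhat (n + 1) a (looResidual bhat q.1) := fun a h0 h1 =>
    (hqhat (n + 1) n.succ_pos a h0 h1).1.comp ((measurable_looResidual hbhat).comp measurable_fst)
  exact (measurableSet_le (hb.add (hq (α / 2) (by linarith) (by linarith)))
    (measurable_fst.comp ho)).inter (measurableSet_le (measurable_fst.comp ho)
      (hb.add (hq (1 - α / 2) (by linarith) (by linarith))))

/-- The conditional coverage probability is the mass that the conditional error law gives to the
interval between the scaled empirical quantiles. -/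
theorem IsDataModel.condCoverage_ae_eq (h : IsDataModel P v l u)
    (hbhat : ∀ m k : ℕ, Measurable (bhat m k)) (hqhat : qhat.IsValid) {α : ℝ} (hα0 : 0 < α)
    (hα1 : α < 1) {k : ℕ} (θ : Param k) (n : ℕ) :
    condCoverage P v l u bhat qhat α θ n =ᵐ[P] fun ω =>
      (errorLaw P v l u (stdRule bhat θ (n + 1) (rawSample v l u k (n + 1) ω))).real
        (Set.Icc
          (qhat (n + 1) (α / 2) (looResidual bhat (training v l u θ (n + 1) ω)) / θ.σ)
          (qhat (n + 1) (1 - α / 2) (looResidual bhat (training v l u θ (n + 1) ω)) / θ.σ)) := by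
  have hto : Measurable fun w : Fin (n + 1) → EuclideanSpace ℝ (Fin k) × ℝ => θ.toObs ∘ w :=
    measurable_pi_lambda _ fun i => θ.measurable_toObs.comp (measurable_pi_apply i)
  have htr : training v l u θ (n + 1) =
      (fun w : Fin (n + 1) → EuclideanSpace ℝ (Fin k) × ℝ => θ.toObs ∘ w) ∘
        rawSample v l u k (n + 1) := rfl
  have hX : Measurable (training v l u θ (n + 1)) := by
    rw [htr]; exact hto.comp (h.measurable_rawSample k (n + 1))
  have hind : IndepFun (training v l u θ (n + 1)) (rawObs v l u k 0) P := by
    rw [htr]; exact (h.indepFun_rawSample_rawObs k (n + 1)).comp hto measurable_id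
  have hset : {ω | response v l u θ 0 ω ∈ looInterval bhat qhat α (training v l u θ (n + 1) ω)
      (regressor v l θ 0 ω)} = {ω | (training v l u θ (n + 1) ω, rawObs v l u k 0 ω) ∈
      {q : (Fin (n + 1) → Obs k) × (EuclideanSpace ℝ (Fin k) × ℝ) |
        (θ.toObs q.2).1 ∈ looInterval bhat qhat α q.1 (θ.toObs q.2).2}} := by
    ext ω; exact Iff.rfl
  have key := condProb_ae_eq_of_indepFun hX (h.measurable_rawObs k 0) hind
    (measurableSet_looInterval (n := n) hbhat hqhat hα0 hα1 θ)
  rw [condCoverage, hset]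
  filter_upwards [key] with ω hω
  rw [hω, errorLaw, map_measureReal_apply (measurable_predError_left _) measurableSet_Icc]
  congr 1
  ext z
  have hσ := θ.σ_pos
  have e := θ.toObs_sub_inner z (bhat (n + 1) k (training v l u θ (n + 1) ω))
  have e' : stdRule bhat θ (n + 1) (rawSample v l u k (n + 1) ω) =
    θ.stdErr (bhat (n + 1) k (training v l u θ (n + 1) ω)) := rfl
  simp only [Set.mem_ofPred_eq, looInterval, Set.mem_Icc, Set.mem_preimage, e', div_le_iff₀ hσ,
    le_div_iff₀ hσ]
  rw [mul_comm _ θ.σ, ← e]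
  constructor <;> rintro ⟨h1, h2⟩ <;> constructor <;> linarith

end Coverage

/-! ### Uniformity over the parameters and conclusion -/

section Conclusion

instance {k : ℕ} : Nonempty (Param k) := ⟨⟨0, 1, 1, one_pos, Matrix.PosDef.one⟩⟩

/-- Uniform convergence to zero follows from convergence along every sequence of parameters. -/
theorem tendsto_iSup_of_forall_seq {T : ℕ → Type*} [∀ n, Nonempty (T n)] {f : ∀ n, T n → ℝ≥0∞}
    (h : ∀ θ : ∀ n, T n, Tendsto (fun n => f n (θ n)) atTop (𝓝 0)) :
    Tendsto (fun n => ⨆ t, f n t) atTop (𝓝 0) := by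
  rw [ENNReal.tendsto_nhds_zero]
  intro ε hε
  by_contra hcon
  have hc : ∀ n, ∃ t, ε < (⨆ t, f n t) → ε < f n t := fun n => by
    by_cases hn : ε < ⨆ t, f n t
    · obtain ⟨t, ht⟩ := lt_iSup_iff.1 hn
      exact ⟨t, fun _ => ht⟩
    · exact ⟨Classical.arbitrary _, fun h => absurd h hn⟩
  choose θ hθ using hc
  refine hcon ?_
  filter_upwards [(ENNReal.tendsto_nhds_zero.1 (h θ)) ε hε] with n hn
  by_contra hlt
  exact absurd hn (not_le.2 (hθ n (not_le.1 hlt)))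

theorem tendsto_of_tendsto_iSup {T : ℕ → Type*} {f : ∀ n, T n → ℝ≥0∞}
    (h : Tendsto (fun n => ⨆ t, f n t) atTop (𝓝 0)) (θ : ∀ n, T n) :
    Tendsto (fun n => f n (θ n)) atTop (𝓝 0) :=
  tendsto_of_tendsto_of_tendsto_of_le_of_le tendsto_const_nhds h (fun _ => zero_le)
    fun n => le_iSup (f n) (θ n)

theorem abs_apply_le_lqNorm {k : ℕ} {q : ℝ} (hq : 0 < q) (b : EuclideanSpace ℝ (Fin k))
    (j : Fin k) : |b j| ≤ lqNorm q b := by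
  have h1 : |b j| ^ q ≤ ∑ j, |b j| ^ q :=
    Finset.single_le_sum (f := fun j => |b j| ^ q)
      (fun j _ => Real.rpow_nonneg (abs_nonneg _) _) (Finset.mem_univ j)
  calc |b j| = (|b j| ^ q) ^ (1 / q) := by
        rw [← Real.rpow_mul (abs_nonneg _), mul_one_div_cancel hq.ne', Real.rpow_one]
    _ ≤ _ := Real.rpow_le_rpow (Real.rpow_nonneg (abs_nonneg _) _) h1 (by positivity)

variable {Ω : Type*} [MeasurableSpace Ω] {P : Measure Ω} [IsProbabilityMeasure P]
  {v : ℕ → ℕ → Ω → ℝ} {l u : ℕ → Ω → ℝ} {p : ℕ → ℕ} {bhat : Estimator} {qhat : QuantileRule}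
  {τ : ℝ}

/-- What the two cases have in common: stability of the estimator, a limit law with a continuous
and strictly increasing distribution function, and a reason for the linear form in the fresh
regressor to be asymptotically normal. -/
structure Regular (P : Measure Ω) (v : ℕ → ℕ → Ω → ℝ) (l u : ℕ → Ω → ℝ) (p : ℕ → ℕ)
    (bhat : Estimator) (τ : ℝ) : Prop where
  condC1 : CondC1 P v l u p bhat τ
  cdf_continuous : Continuous (cdf (limitLaw P l u τ))
  cdf_strictMono : StrictMono (cdf (limitLaw P l u τ))
  gauss_or_delocalized : P.map (v 0 0) = gaussianReal 0 1 ∨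
    ∀ ε : ℝ, 0 < ε → Tendsto (fun n : ℕ => ⨆ θ : Param (p (n + 1)),
      P {ω | ∃ j, ε < |scaledError v l u bhat θ (n + 1) ω j|}) atTop (𝓝 0)

theorem CasePos.regular (hmodel : IsDataModel P v l u) (h : CasePos P v l u p bhat τ) :
    Regular P v l u p bhat τ where
  condC1 := h.condC1
  cdf_continuous := hmodel.continuous_cdf_limitLaw h.pos
  cdf_strictMono := hmodel.strictMono_cdf_limitLaw h.pos
  gauss_or_delocalized := by
    rcases h.c2_or_gauss with ⟨δ, hδ, -, hC2⟩ | hG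
    · refine Or.inr fun ε hε => tendsto_of_tendsto_of_tendsto_of_le_of_le tendsto_const_nhds
        (hC2 ε hε) (fun _ => zero_le) fun n => iSup_mono fun θ => measure_mono ?_
      rintro ω ⟨j, hj⟩
      exact hj.trans_le (abs_apply_le_lqNorm (by linarith) _ j)
    · exact Or.inl (hG 0 0)

theorem CaseZero.regular (hmodel : IsDataModel P v l u) (h : CaseZero P v l u p bhat τ) :
    Regular P v l u p bhat τ where
  condC1 := h.condC1
  cdf_continuous := by rw [h.eq_zero, hmodel.limitLaw_zero]; exact h.cdf_continuous
  cdf_strictMono := by rw [h.eq_zero, hmodel.limitLaw_zero]; exact h.cdf_strictMono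
  gauss_or_delocalized := by
    -- for `τ = 0` the coordinates vanish with the norm
    refine Or.inr fun ε hε => tendsto_of_tendsto_of_tendsto_of_le_of_le tendsto_const_nhds
      (h.condC1.error_tendsto ε hε) (fun _ => zero_le) fun n => iSup_mono fun θ => measure_mono ?_
    rintro ω ⟨j, hj⟩
    have h1 := PiLp.norm_apply_le (scaledError v l u bhat θ (n + 1) ω) j
    rw [Real.norm_eq_abs] at h1
    simp only [Set.mem_ofPred_eq, h.eq_zero, sub_zero, abs_norm]
    exact hj.trans_le h1

/-- The conditional distribution function of the scaled prediction error converges in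
probability. -/
theorem Regular.tendstoInMeasure_errorLaw (h : Regular P v l u p bhat τ)
    (hmodel : IsDataModel P v l u) (θ : (n : ℕ) → Param (p (n + 1))) (t : ℝ) :
    TendstoInMeasure P (fun n ω => (errorLaw P v l u (stdRule bhat (θ n) (n + 1)
      (rawSample v l u (p (n + 1)) (n + 1) ω))).real (Set.Iic t)) atTop
      (fun _ => cdf (limitLaw P l u τ) t) := by
  have hpl := hmodel.isProbabilityMeasure_limitLaw τ
  refine tendstoInMeasure_cdf h.cdf_continuous
    (H := fun n ω t => (errorLaw P v l u (stdRule bhat (θ n) (n + 1)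
      (rawSample v l u (p (n + 1)) (n + 1) ω))).real (Set.Iic t))
    (A := fun t h n ω => ∫ x, ramp t h x ∂(errorLaw P v l u (stdRule bhat (θ n) (n + 1)
      (rawSample v l u (p (n + 1)) (n + 1) ω)))) (fun t h n ω hh => ?_) (fun t h n ω hh => ?_)
    (fun t r hr => ?_) t
  · have := hmodel.isProbabilityMeasure_errorLaw (stdRule bhat (θ n) (n + 1)
      (rawSample v l u (p (n + 1)) (n + 1) ω))
    rw [← cdf_eq_real]
    exact integral_ramp_le_cdf hh
  · have := hmodel.isProbabilityMeasure_errorLaw (stdRule bhat (θ n) (n + 1)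
      (rawSample v l u (p (n + 1)) (n + 1) ω))
    rw [← cdf_eq_real]
    exact cdf_le_integral_ramp hh
  · exact hmodel.tendstoInMeasure_integral_errorLaw (k := fun n => p (n + 1))
      (D := fun n => stdRule bhat (θ n) (n + 1))
      (fun ε hε => tendsto_of_tendsto_iSup (h.condC1.error_tendsto ε hε) θ)
      (h.gauss_or_delocalized.imp_right fun hd ε hε => tendsto_of_tendsto_iSup (hd ε hε) θ)
      (rampBCF t r)

theorem card_filter_eq_sum {m : ℕ} (z : Fin m → ℝ) (t : ℝ) :
    ((Finset.univ.filter fun i => z i ≤ t).card : ℝ) =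
      ∑ i, (Set.Iic t).indicator (fun _ => (1 : ℝ)) (z i) := by
  rw [Finset.natCast_card_filter]
  refine Finset.sum_congr rfl fun i _ => ?_
  simp [Set.indicator_apply]

/-- The empirical distribution function of the scaled leave-one-out residuals converges in
probability. -/
theorem Regular.tendstoInMeasure_empirical (h : Regular P v l u p bhat τ)
    (hmodel : IsDataModel P v l u) (hbhat : ∀ m k : ℕ, Measurable (bhat m k))
    (θ : (n : ℕ) → Param (p (n + 1))) (t : ℝ) :
    TendstoInMeasure P (fun n ω => ((Finset.univ.filter fun i =>
      looResidual bhat (training v l u (θ n) (n + 1) ω) i ≤ (θ n).σ * t).card : ℝ) / (n + 1 : ℝ))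
      atTop (fun _ => cdf (limitLaw P l u τ) t) := by
  have hpl := hmodel.isProbabilityMeasure_limitLaw τ
  let r : (n : ℕ) → Ω → Fin (n + 1) → ℝ := fun n ω i =>
    predError (rawSample v l u (p (n + 1)) (n + 1) ω i)
      (stdRule bhat (θ n) n (i.removeNth (rawSample v l u (p (n + 1)) (n + 1) ω)))
  have hcard : ∀ n ω t, ((Finset.univ.filter fun i =>
      looResidual bhat (training v l u (θ n) (n + 1) ω) i ≤ (θ n).σ * t).card : ℝ) =
      ∑ i, (Set.Iic t).indicator (fun _ => (1 : ℝ)) (r n ω i) := fun n ω t => by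
    rw [← card_filter_eq_sum]
    simp only [training_eq, looResidual_eq, mul_le_mul_iff_right₀ (θ n).σ_pos, r]
  simp only [hcard]
  have hN : ∀ n : ℕ, (0 : ℝ) < n + 1 := fun n => by positivity
  refine tendstoInMeasure_cdf h.cdf_continuous
    (H := fun n ω t => (∑ i, (Set.Iic t).indicator (fun _ => (1 : ℝ)) (r n ω i)) / (n + 1 : ℝ))
    (A := fun t h n ω => (∑ i, ramp t h (r n ω i)) / (n + 1 : ℝ))
    (fun t h n ω hh => ?_) (fun t h n ω hh => ?_) (fun t s hs => ?_) t
  · exact div_le_div_of_nonneg_right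
      (Finset.sum_le_sum fun i _ => ramp_le_indicator_Iic hh _) (hN n).le
  · exact div_le_div_of_nonneg_right
      (Finset.sum_le_sum fun i _ => indicator_Iic_le_ramp hh _) (hN n).le
  · refine hmodel.tendstoInMeasure_average (k := fun n => p (n + 1))
      (D := fun n => stdRule bhat (θ n) (n + 1)) (D' := fun n => stdRule bhat (θ n) n)
      (fun n => measurable_stdRule hbhat _ _) (fun n => measurable_stdRule hbhat _ _)
      (fun n w π => ?_)
      (fun ε hε => tendsto_of_tendsto_iSup (h.condC1.error_tendsto ε hε) θ)
      (h.gauss_or_delocalized.imp_right fun hd ε hε => tendsto_of_tendsto_iSup (hd ε hε) θ)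
      (fun ε hε => ?_) (rampBCF t s) (lipschitzWith_ramp t s).choose_spec
    · simp only [stdRule]
      rw [← Function.comp_assoc, h.condC1.symmetric]
    · have := tendsto_of_tendsto_iSup (h.condC1.influence_tendsto ε hε) θ
      simpa only [scaledInfluence_eq] using this

/-- The scaled empirical quantiles of the leave-one-out residuals converge in probability. -/
theorem Regular.tendstoInMeasure_quantile (h : Regular P v l u p bhat τ)
    (hmodel : IsDataModel P v l u) (hbhat : ∀ m k : ℕ, Measurable (bhat m k))
    (hqhat : qhat.IsValid) (θ : (n : ℕ) → Param (p (n + 1))) {a : ℝ} (ha0 : 0 < a) (ha1 : a < 1) :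
    TendstoInMeasure P (fun n ω =>
      qhat (n + 1) a (looResidual bhat (training v l u (θ n) (n + 1) ω)) / (θ n).σ) atTop
      (fun _ => quantile (limitLaw P l u τ) a) := by
  have hpl := hmodel.isProbabilityMeasure_limitLaw τ
  have hN : ∀ n : ℕ, (0 : ℝ) < n + 1 := fun n => by positivity
  refine LooPred.tendstoInMeasure_quantile h.cdf_strictMono
    (h.tendstoInMeasure_empirical hmodel hbhat θ) (quantile_spec h.cdf_continuous ha0 ha1)
    (fun n ω t ht => ?_) (fun n ω t ht => ?_)
  all_goals
    obtain ⟨h1, h2⟩ := (hqhat (n + 1) n.succ_pos a ha0 ha1).2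
      (looResidual bhat (training v l u (θ n) (n + 1) ω))
    push_cast at h1 h2
  · rw [div_lt_iff₀ (θ n).σ_pos, mul_comm] at ht
    rw [le_div_iff₀ (hN n)]
    refine h1.trans (Nat.cast_le.2 (Finset.card_le_card fun i hi => ?_))
    simp only [Finset.mem_filter, Finset.mem_univ, true_and] at hi ⊢
    linarith
  · rw [lt_div_iff₀ (θ n).σ_pos, mul_comm] at ht
    rw [div_le_iff₀ (hN n)]
    refine le_trans (Nat.cast_le.2 (Finset.card_le_card fun i hi => ?_)) h2
    simp only [Finset.mem_filter, Finset.mem_univ, true_and] at hi ⊢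
    linarith

theorem Regular.tendstoInMeasure_length (h : Regular P v l u p bhat τ)
    (hmodel : IsDataModel P v l u) (hbhat : ∀ m k : ℕ, Measurable (bhat m k))
    (hqhat : qhat.IsValid) {α : ℝ} (hα0 : 0 < α) (hα1 : α < 1)
    (θ : (n : ℕ) → Param (p (n + 1))) :
    TendstoInMeasure P (fun n ω => looLength bhat qhat α
      (training v l u (θ n) (n + 1) ω) / (θ n).σ) atTop (fun _ => limitLength P l u τ α) := by
  have h1 := h.tendstoInMeasure_quantile hmodel hbhat hqhat θ (a := 1 - α / 2) (by linarith)
    (by linarith)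
  have h2 := h.tendstoInMeasure_quantile hmodel hbhat hqhat θ (a := α / 2) (by linarith)
    (by linarith)
  simpa only [looLength, limitLength, sub_div] using tendstoInMeasure_sub h1 h2

theorem Regular.isHonest (h : Regular P v l u p bhat τ)
    (hmodel : IsDataModel P v l u) (hbhat : ∀ m k : ℕ, Measurable (bhat m k))
    (hqhat : qhat.IsValid) {α : ℝ} (hα0 : 0 < α) (hα1 : α < 1) :
    IsHonest P v l u p bhat qhat α := by
  have hpl := hmodel.isProbabilityMeasure_limitLaw τ
  refine tendsto_iSup_of_forall_seq fun θ => ?_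
  have h1 := h.tendstoInMeasure_quantile hmodel hbhat hqhat θ (a := 1 - α / 2) (by linarith)
    (by linarith)
  have h2 := h.tendstoInMeasure_quantile hmodel hbhat hqhat θ (a := α / 2) (by linarith)
    (by linarith)
  have s1 := quantile_spec (m := limitLaw P l u τ) h.cdf_continuous (a := 1 - α / 2)
    (by linarith) (by linarith)
  have s2 := quantile_spec (m := limitLaw P l u τ) h.cdf_continuous (a := α / 2)
    (by linarith) (by linarith)
  have hle : quantile (limitLaw P l u τ) (α / 2) ≤ quantile (limitLaw P l u τ) (1 - α / 2) :=
    h.cdf_strictMono.le_iff_le.1 (by rw [s1, s2]; linarith)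
  have hcov := tendstoInMeasure_measureReal_Icc h.cdf_continuous
    (fun n ω => hmodel.isProbabilityMeasure_errorLaw _)
    (h.tendstoInMeasure_errorLaw hmodel θ) hle h2 h1
  rw [s1, s2, show 1 - α / 2 - α / 2 = 1 - α by ring] at hcov
  refine (tendsto_lintegral_abs_sub (C := 1) hcov fun n ω => ?_).congr fun n => ?_
  · have := hmodel.isProbabilityMeasure_errorLaw (stdRule bhat (θ n) (n + 1)
      (rawSample v l u (p (n + 1)) (n + 1) ω))
    have a1 := measureReal_nonneg (μ := errorLaw P v l u (stdRule bhat (θ n) (n + 1)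
      (rawSample v l u (p (n + 1)) (n + 1) ω))) (s := Set.Icc
        (qhat (n + 1) (α / 2) (looResidual bhat (training v l u (θ n) (n + 1) ω)) / (θ n).σ)
        (qhat (n + 1) (1 - α / 2) (looResidual bhat (training v l u (θ n) (n + 1) ω)) / (θ n).σ))
    have a2 := measureReal_le_one (μ := errorLaw P v l u (stdRule bhat (θ n) (n + 1)
      (rawSample v l u (p (n + 1)) (n + 1) ω))) (s := Set.Icc
        (qhat (n + 1) (α / 2) (looResidual bhat (training v l u (θ n) (n + 1) ω)) / (θ n).σ)
        (qhat (n + 1) (1 - α / 2) (looResidual bhat (training v l u (θ n) (n + 1) ω)) / (θ n).σ))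
    rw [abs_le]
    constructor <;> linarith
  · refine lintegral_congr_ae ?_
    filter_upwards [hmodel.condCoverage_ae_eq hbhat hqhat hα0 hα1 (θ n) n] with ω hω
    rw [hω]

end Conclusion

end LooPred

theorem theorem1 {Ω : Type*} [MeasurableSpace Ω] (P : Measure Ω) [IsProbabilityMeasure P]
    (v : ℕ → ℕ → Ω → ℝ) (l u : ℕ → Ω → ℝ) (hmodel : LooPred.IsDataModel P v l u)
    (p : ℕ → ℕ) (bhat : LooPred.Estimator) (hbhat : ∀ m k : ℕ, Measurable (bhat m k))
    (qhat : LooPred.QuantileRule) (hqhat : qhat.IsValid)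
    (α : ℝ) (hα0 : 0 < α) (hα1 : α < 1) :
    (∀ τ : ℝ, LooPred.CasePos P v l u p bhat τ → LooPred.IsHonest P v l u p bhat qhat α) ∧
    (∀ τ : ℝ, LooPred.CaseZero P v l u p bhat τ → LooPred.IsHonest P v l u p bhat qhat α) ∧
    (∀ τ : ℝ, (LooPred.CasePos P v l u p bhat τ ∨ LooPred.CaseZero P v l u p bhat τ) →
      ∀ θ : (n : ℕ) → LooPred.Param (p (n + 1)),
        TendstoInMeasure P
          (fun n ω => LooPred.looLength bhat qhat α
            (LooPred.training v l u (θ n) (n + 1) ω) / (θ n).σ)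
          atTop (fun _ => LooPred.limitLength P l u τ α)) := by
  exact ⟨fun τ h => (h.regular hmodel).isHonest hmodel hbhat hqhat hα0 hα1,
    fun τ h => (h.regular hmodel).isHonest hmodel hbhat hqhat hα0 hα1,
    fun τ h θ => (h.elim (fun h => h.regular hmodel)
      fun h => h.regular hmodel).tendstoInMeasure_length hmodel hbhat hqhat hα0 hα1 θ⟩
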